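/- **Theorem.** All C*-algebras and all \*-homomorphisms are unital, and $\otimes$ is the minimal (spatial) tensor product of C\*-algebras. A compact quantum space $\mathbb X$ is the formal dual object of a C\*-algebra, which is denoted by $C(\mathbb X)$; it is finite if $\dim C(\mathbb X)<\infty$. A quantum family of maps $\mathbb X\to\mathbb Y$ parametrized by $\mathbb D$ is a \*-homomorphism $\Psi\colon C(\mathbb Y)\to C(\mathbb X)\otimes C(\mathbb D)$. A quantum family $\Phi\colon C(\mathbb Y)\to C(\mathbb X)\otimes C(\mathbb E)$ is the quantum family of all maps $\mathbb X\to\mathbb Y$ (and $\mathbb E$ is the quantum space of all maps $\mathbb X\to\mathbb Y$) if for every $\mathbb D$ and every \*-homomorphism $\Psi\colon C(\mathbb Y)\to C(\mathbb X)\otimes C(\mathbb D)$ there is a unique \*-homomorphism $\Lambda\colon C(\mathbb E)\to C(\mathbb D)$ with $(\mathrm{id}\otimes\Lambda)\circ\Phi=\Psi$. For $\Psi_1\colon C(\mathbb X_2)\to C(\mathbb X_1)\otimes C(\mathbb D_1)$ and $\Psi_2\colon C(\mathbb X_3)\to C(\mathbb X_2)\otimes C(\mathbb D_2)$ put $$\Psi_1\vartriangle\Psi_2=(\Psi_1\otimes\mathrm{id})\circ\Psi_2\colon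 C(\mathbb X_3)\to C(\mathbb X_1)\otimes C(\mathbb D_1)\otimes C(\mathbb D_2).$$ Let $\mathbb M$ be a finite quantum space, and let $\Phi\colon C(\mathbb M)\to C(\mathbb M)\otimes C(\mathbb E)$ be the quantum family of all maps $\mathbb M\to\mathbb M$. 1. There is a unique \*-homomorphism $\Delta\colon C(\mathbb E)\to C(\mathbb E)\otimes C(\mathbb E)$ such that $\Phi\vartriangle\Phi=(\mathrm{id}\otimes\Delta)\circ\Phi$. 2. This $\Delta$ is coassociative: $(\Delta\otimes\mathrm{id})\circ\Delta=(\mathrm{id}\otimes\Delta)\circ\Delta$. 3. There is a unique character $\varepsilon$ of $C(\mathbb E)$ (a unital \*-homomorphism $\varepsilon\colon C(\mathbb E)\to\mathbb C$) such that $(\mathrm{id}\otimes\varepsilon)\circ\Phi=\mathrm{id}$, and it also satisfies $(\varepsilon\otimes\mathrm{id})\circ\Delta=(\mathrm{id}\otimes\varepsilon)\circ\Delta=\mathrm{id}$. In particular $\mathbb E$ with $\Delta$ is a compact quantum semigroup with unit, that is, $\Delta$ is coassociative and there is a character $\varepsilon$ of $C(\mathbb E)$ with $(\varepsilon\otimes\mathrm{id})\circ\Delta=(\mathrm{id}\otimes\varepsilon)\circ\Delta=\mathrm{id}$.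 -/

import Mathlib

universe u

open scoped TensorProduct ComplexOrder

namespace QuantumSpace

open UniformSpace

section Completion

/-- A C*-seminorm on a unital complex *-algebra. -/
structure CStarSeminorm (T : Type u) [Ring T] [StarRing T] [Algebra ℂ T] extends
    Seminorm ℂ T where
  mul_le' : ∀ x y : T, toFun (x * y) ≤ toFun x * toFun y
  mul_self_le' : ∀ x : T, toFun x * toFun x ≤ toFun (star x * x)

variable {T : Type u} [Ring T] [StarRing T] [Algebra ℂ T]

/-- The *-algebra `T` regarded as a seminormed *-algebra through the C*-seminorm `p`. -/
def CStarSeminorm.Alg (_p : CStarSeminorm T) : Type u := T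

variable (p : CStarSeminorm T)

instance : Ring p.Alg := inferInstanceAs (Ring T)
instance : StarRing p.Alg := inferInstanceAs (StarRing T)
instance : Algebra ℂ p.Alg := inferInstanceAs (Algebra ℂ T)
instance [StarModule ℂ T] : StarModule ℂ p.Alg := inferInstanceAs (StarModule ℂ T)

noncomputable instance : SeminormedRing p.Alg where
  __ := (show AddGroupSeminorm p.Alg from
    p.toSeminorm.toAddGroupSeminorm).toSeminormedAddGroup
  __ := (inferInstance : Ring p.Alg)
  norm_mul_le := p.mul_le'

theorem CStarSeminorm.norm_def (x : p.Alg) : ‖x‖ = p.toSeminorm x := rfl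

noncomputable instance : NormedAlgebra ℂ p.Alg where
  norm_smul_le c x := (map_smul_eq_mul p.toSeminorm c x).le

theorem CStarSeminorm.norm_mul_self_le (x : p.Alg) : ‖x‖ * ‖x‖ ≤ ‖star x * x‖ :=
  p.mul_self_le' x

instance : NormedStarGroup p.Alg where
  norm_star_le x := by
    rcases (norm_nonneg (star x)).eq_or_lt with h | h
    · rw [← h]; exact norm_nonneg x
    · have h1 := p.norm_mul_self_le (star x)
      rw [star_star] at h1
      have h2 := norm_mul_le x (star x)
      exact le_of_mul_le_mul_right (h1.trans h2) h

/-- The separated completion of `T` with respect to `p`. -/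
abbrev CStarSeminorm.Compl : Type u := Completion p.Alg

noncomputable instance : Star p.Compl := ⟨Completion.map star⟩

theorem CStarSeminorm.star_coe (x : p.Alg) : star (x : p.Compl) = ((star x : p.Alg) : p.Compl) :=
  Completion.map_coe (star_isometry (E := p.Alg)).uniformContinuous x

theorem CStarSeminorm.continuous_star : Continuous (star : p.Compl → p.Compl) :=
  Completion.continuous_map

noncomputable instance : StarRing p.Compl where
  star_involutive x := by
    induction x using Completion.induction_on with
    | hp => exact isClosed_eq (p.continuous_star.comp p.continuous_star) continuous_id
    | ih x => simp [p.star_coe]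
  star_mul x y := by
    induction x, y using Completion.induction_on₂ with
    | hp =>
      exact isClosed_eq (p.continuous_star.comp continuous_mul)
        ((p.continuous_star.comp continuous_snd).mul (p.continuous_star.comp continuous_fst))
    | ih x y => rw [← Completion.coe_mul, p.star_coe, p.star_coe, p.star_coe, star_mul,
        Completion.coe_mul]
  star_add x y := by
    induction x, y using Completion.induction_on₂ with
    | hp =>
      exact isClosed_eq (p.continuous_star.comp continuous_add)
        ((p.continuous_star.comp continuous_fst).add (p.continuous_star.comp continuous_snd))
    | ih x y => rw [← Completion.coe_add, p.star_coe, p.star_coe, p.star_coe, star_add,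
        Completion.coe_add]

noncomputable instance : NormedAlgebra ℂ p.Compl where
  __ := (inferInstance : Algebra ℂ p.Compl)
  norm_smul_le := (inferInstance : NormedSpace ℂ p.Compl).norm_smul_le

noncomputable instance [StarModule ℂ T] : CStarAlgebra p.Compl where
  norm_mul_self_le x := by
    induction x using Completion.induction_on with
    | hp =>
      exact isClosed_le (continuous_norm.mul continuous_norm)
        (continuous_norm.comp (p.continuous_star.mul continuous_id))
    | ih x =>
      rw [p.star_coe, ← Completion.coe_mul, Completion.norm_coe, Completion.norm_coe]
      exact p.norm_mul_self_le x
  star_smul c x := by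
    induction x using Completion.induction_on with
    | hp =>
      exact isClosed_eq (p.continuous_star.comp (continuous_const_smul c))
        (p.continuous_star.const_smul (star c))
    | ih x => rw [← Completion.coe_smul, p.star_coe, p.star_coe, star_smul, Completion.coe_smul]

/-- The C*-algebra obtained from `T` by separation and completion with respect to `p`. -/
def CStarSeminorm.CAlg : Type u := p.Compl

noncomputable instance instCStarAlgebraCAlg [StarModule ℂ T] : CStarAlgebra p.CAlg :=
  inferInstanceAs (CStarAlgebra p.Compl)

variable [StarModule ℂ T]

/-- The identity map `p.Alg → T`. -/
def CStarSeminorm.ofAlg : p.Alg →⋆ₐ[ℂ] T where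
  toFun x := x
  map_one' := rfl
  map_mul' _ _ := rfl
  map_zero' := rfl
  map_add' _ _ := rfl
  commutes' _ := rfl
  map_star' _ := rfl

/-- The canonical *-homomorphism of `T` onto a dense *-subalgebra of its completion. -/
noncomputable def CStarSeminorm.incl : T →⋆ₐ[ℂ] p.CAlg :=
  show T →⋆ₐ[ℂ] p.Compl from
  { toFun := fun x => ((show p.Alg from x) : p.Compl)
    map_one' := rfl
    map_mul' := fun x y => Completion.coe_mul (α := p.Alg) x y
    map_zero' := rfl
    map_add' := fun x y => Completion.coe_add (α := p.Alg) x y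
    commutes' := fun _ => rfl
    map_star' := fun x => (p.star_coe x).symm }

theorem CStarSeminorm.norm_incl (x : T) : ‖p.incl x‖ = p.toSeminorm x :=
  Completion.norm_coe (E := p.Alg) x

theorem CStarSeminorm.denseRange_incl : DenseRange p.incl :=
  Completion.denseRange_coe (α := p.Alg)

variable {D : Type u} [CStarAlgebra D]

theorem CStarSeminorm.continuous_of_le {p : CStarSeminorm T} (f : T →⋆ₐ[ℂ] D)
    (h : ∀ x, ‖f x‖ ≤ p.toSeminorm x) :
    Continuous ((f.comp p.ofAlg).toAlgHom.toRingHom) :=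
  AddMonoidHomClass.continuous_of_bound ((f.comp p.ofAlg).toAlgHom.toRingHom) 1
    (fun x => by rw [one_mul]; exact h x)

/-- The extension of a *-homomorphism dominated by `p` to the completion. -/
noncomputable def CStarSeminorm.liftCompl (p : CStarSeminorm T) (f : T →⋆ₐ[ℂ] D)
    (h : ∀ x, ‖f x‖ ≤ p.toSeminorm x) : p.Compl →⋆ₐ[ℂ] D where
  __ := Completion.extensionHom ((f.comp p.ofAlg).toAlgHom.toRingHom)
    (CStarSeminorm.continuous_of_le f h)
  commutes' r := (Completion.extensionHom_coe _ (CStarSeminorm.continuous_of_le f h)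
    (algebraMap ℂ p.Alg r)).trans (f.toAlgHom.commutes r)
  map_star' x := by
    change Completion.extensionHom _ (CStarSeminorm.continuous_of_le f h) (star x) =
      star (Completion.extensionHom _ (CStarSeminorm.continuous_of_le f h) x)
    have hc : Continuous (Completion.extensionHom _ (CStarSeminorm.continuous_of_le f h)) :=
      Completion.continuous_extension
    induction x using Completion.induction_on with
    | hp => exact isClosed_eq (hc.comp p.continuous_star) (ContinuousStar.continuous_star.comp hc)
    | ih x =>
      rw [p.star_coe, Completion.extensionHom_coe, Completion.extensionHom_coe]
      exact map_star f x

/-- A *-homomorphism of `T` into a C*-algebra which is dominated by `p` extends to the completion. -/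
noncomputable def CStarSeminorm.lift (p : CStarSeminorm T) (f : T →⋆ₐ[ℂ] D)
    (h : ∀ x, ‖f x‖ ≤ p.toSeminorm x) : p.CAlg →⋆ₐ[ℂ] D :=
  p.liftCompl f h

theorem CStarSeminorm.lift_incl (p : CStarSeminorm T) (f : T →⋆ₐ[ℂ] D)
    (h : ∀ x, ‖f x‖ ≤ p.toSeminorm x) (x : T) : p.lift f h (p.incl x) = f x :=
  Completion.extensionHom_coe (α := p.Alg) _ (CStarSeminorm.continuous_of_le f h) x

attribute [irreducible] instCStarAlgebraCAlg CStarSeminorm.CAlg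

/-- The supremum of a pointwise bounded family of C*-seminorms. -/
noncomputable def CStarSeminorm.iSup {T : Type u} [Ring T] [StarRing T] [Algebra ℂ T]
    {ι : Type*} (q : ι → CStarSeminorm T)
    (hb : ∀ x, BddAbove (Set.range fun i => (q i).toSeminorm x)) : CStarSeminorm T where
  toFun x := ⨆ i, (q i).toSeminorm x
  map_zero' := by simp
  add_le' x y := Real.iSup_le (fun i => (map_add_le_add (q i).toSeminorm x y).trans
      (add_le_add (le_ciSup (hb x) i) (le_ciSup (hb y) i)))
    (add_nonneg (Real.iSup_nonneg fun i => apply_nonneg _ _)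
      (Real.iSup_nonneg fun i => apply_nonneg _ _))
  neg' x := by simp
  smul' c x := by simp only [map_smul_eq_mul]; exact (Real.mul_iSup_of_nonneg (norm_nonneg c) _).symm
  mul_le' x y := Real.iSup_le (fun i => ((q i).mul_le' x y).trans
      (mul_le_mul (le_ciSup (hb x) i) (le_ciSup (hb y) i) (apply_nonneg (q i).toSeminorm _)
        (Real.iSup_nonneg fun i => apply_nonneg _ _)))
    (mul_nonneg (Real.iSup_nonneg fun i => apply_nonneg _ _)
      (Real.iSup_nonneg fun i => apply_nonneg _ _))
  mul_self_le' x := by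
    have h0 : 0 ≤ ⨆ i, (q i).toSeminorm (star x * x) := Real.iSup_nonneg fun i => apply_nonneg _ _
    have h1 : (⨆ i, (q i).toSeminorm x) ≤ √(⨆ i, (q i).toSeminorm (star x * x)) :=
      Real.iSup_le (fun i => Real.le_sqrt_of_sq_le (by
        rw [pow_two]
        exact ((q i).mul_self_le' x).trans (le_ciSup (hb (star x * x)) i))) (Real.sqrt_nonneg _)
    calc _ ≤ √(⨆ i, (q i).toSeminorm (star x * x)) * √(⨆ i, (q i).toSeminorm (star x * x)) :=
          mul_self_le_mul_self (Real.iSup_nonneg fun i => apply_nonneg _ _) h1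
      _ = _ := Real.mul_self_sqrt h0

/-- The C*-seminorm `x ↦ ‖f x‖` of a *-homomorphism into a C*-algebra. -/
noncomputable def CStarSeminorm.ofHom {T : Type u} [Ring T] [StarRing T] [Algebra ℂ T]
    {D : Type*} [CStarAlgebra D] (f : T →⋆ₐ[ℂ] D) : CStarSeminorm T where
  toSeminorm := (normSeminorm ℂ D).comp f.toAlgHom.toLinearMap
  mul_le' x y := by
    change ‖f (x * y)‖ ≤ ‖f x‖ * ‖f y‖
    rw [map_mul]; exact norm_mul_le _ _
  mul_self_le' x := by
    change ‖f x‖ * ‖f x‖ ≤ ‖f (star x * x)‖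
    rw [map_mul, map_star, CStarRing.norm_star_mul_self]

end Completion

section Representations

/-- A representation of a unital *-algebra on a Hilbert space. -/
structure Rep (T : Type u) [Ring T] [StarRing T] [Algebra ℂ T] : Type (u + 1) where
  space : Type u
  [normed : NormedAddCommGroup space]
  [inner : InnerProductSpace ℂ space]
  [complete : CompleteSpace space]
  hom : T →⋆ₐ[ℂ] (space →L[ℂ] space)

attribute [instance] Rep.normed Rep.inner Rep.complete

variable {S T : Type u} [Ring S] [StarRing S] [Algebra ℂ S] [StarModule ℂ S]
  [Ring T] [StarRing T] [Algebra ℂ T] [StarModule ℂ T]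

section Operators

variable {H K : Type u} [NormedAddCommGroup H] [InnerProductSpace ℂ H]
  [NormedAddCommGroup K] [InnerProductSpace ℂ K]

/-- The Hilbert space tensor product. -/
abbrev HilbertTensor (H K : Type u) [NormedAddCommGroup H] [InnerProductSpace ℂ H]
    [NormedAddCommGroup K] [InnerProductSpace ℂ K] : Type u := Completion (H ⊗[ℂ] K)

/-- The bounded operator `a ⊗ b` on the Hilbert space tensor product. -/
noncomputable def opTensor (a : H →L[ℂ] H) (b : K →L[ℂ] K) :
    HilbertTensor H K →L[ℂ] HilbertTensor H K := (TensorProduct.mapL a b).completion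

theorem opTensor_coe (a : H →L[ℂ] H) (b : K →L[ℂ] K) (x : H ⊗[ℂ] K) :
    opTensor a b (x : HilbertTensor H K) = (TensorProduct.mapL a b x : H ⊗[ℂ] K) :=
  ContinuousLinearMap.completion_apply_coe _ _

theorem op_ext {f g : HilbertTensor H K →L[ℂ] HilbertTensor H K}
    (h : ∀ x : H ⊗[ℂ] K, f x = g x) : f = g := by
  ext x
  induction x using Completion.induction_on with
  | hp => exact isClosed_eq f.continuous g.continuous
  | ih x => exact h x

theorem norm_opTensor_le (a : H →L[ℂ] H) (b : K →L[ℂ] K) : ‖opTensor a b‖ ≤ ‖a‖ * ‖b‖ := by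
  refine ContinuousLinearMap.opNorm_le_bound _ (by positivity) fun x => ?_
  induction x using Completion.induction_on with
  | hp => exact isClosed_le (by fun_prop) (by fun_prop)
  | ih x =>
    rw [opTensor_coe, Completion.norm_coe, Completion.norm_coe]
    exact ContinuousLinearMap.le_of_opNorm_le _ (TensorProduct.norm_mapL_le a b) x

theorem opTensor_mul (a a' : H →L[ℂ] H) (b b' : K →L[ℂ] K) :
    opTensor (a * a') (b * b') = opTensor a b * opTensor a' b' :=
  op_ext fun x => by
    rw [mul_apply_eq_comp, opTensor_coe, opTensor_coe, opTensor_coe,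
      TensorProduct.mapL_mul, mul_apply_eq_comp]

/-- `opTensor` as a bilinear map. -/
noncomputable def opTensorBilin :
    (H →L[ℂ] H) →ₗ[ℂ] (K →L[ℂ] K) →ₗ[ℂ] (HilbertTensor H K →L[ℂ] HilbertTensor H K) :=
  LinearMap.mk₂ ℂ opTensor
      (fun a a' b => op_ext fun x => by
        rw [add_apply, opTensor_coe, opTensor_coe, opTensor_coe,
          TensorProduct.mapL_add_left, add_apply, Completion.coe_add])
      (fun c a b => op_ext fun x => by
        rw [smul_apply, opTensor_coe, opTensor_coe,
          TensorProduct.mapL_smul_left, smul_apply, Completion.coe_smul])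
      (fun a b b' => op_ext fun x => by
        rw [add_apply, opTensor_coe, opTensor_coe, opTensor_coe,
          TensorProduct.mapL_add_right, add_apply, Completion.coe_add])
      (fun c a b => op_ext fun x => by
        rw [smul_apply, opTensor_coe, opTensor_coe,
          TensorProduct.mapL_smul_right, smul_apply, Completion.coe_smul])

theorem opTensor_one : opTensor (1 : H →L[ℂ] H) (1 : K →L[ℂ] K) = 1 :=
  op_ext fun x => (opTensor_coe (1 : H →L[ℂ] H) (1 : K →L[ℂ] K) x).trans (by
    have h : TensorProduct.mapL (1 : H →L[ℂ] H) (1 : K →L[ℂ] K) = .id ℂ _ :=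
      TensorProduct.mapL_id_id
    rw [h]; rfl)

/-- `opTensor` as an algebra homomorphism on `B(H) ⊗ B(K)`. -/
noncomputable def opTensorAlgHom :
    (H →L[ℂ] H) ⊗[ℂ] (K →L[ℂ] K) →ₐ[ℂ] (HilbertTensor H K →L[ℂ] HilbertTensor H K) :=
  Algebra.TensorProduct.algHomOfLinearMapTensorProduct (TensorProduct.lift opTensorBilin)
    (fun a a' b b' => opTensor_mul a a' b b') opTensor_one

variable [CompleteSpace H] [CompleteSpace K]

theorem opTensor_star (a : H →L[ℂ] H) (b : K →L[ℂ] K) :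
    opTensor (star a) (star b) = star (opTensor a b) := by
  rw [ContinuousLinearMap.star_eq_adjoint (opTensor a b)]
  refine (ContinuousLinearMap.eq_adjoint_iff _ _).mpr fun x y => ?_
  induction x, y using Completion.induction_on₂ with
  | hp => exact isClosed_eq (by fun_prop) (by fun_prop)
  | ih x y =>
    rw [opTensor_coe, opTensor_coe, Completion.inner_coe, Completion.inner_coe]
    induction x with
    | zero => simp
    | add x x' h h' => rw [map_add, inner_add_left, inner_add_left, h, h']
    | tmul x x' =>
      induction y with
      | zero => simp
      | add y y' h h' => rw [map_add, inner_add_right, inner_add_right, h, h']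
      | tmul y y' =>
        rw [TensorProduct.mapL_tmul, TensorProduct.mapL_tmul, TensorProduct.inner_tmul,
          TensorProduct.inner_tmul, ContinuousLinearMap.star_eq_adjoint,
          ContinuousLinearMap.star_eq_adjoint, ContinuousLinearMap.adjoint_inner_left,
          ContinuousLinearMap.adjoint_inner_left]

/-- `opTensor` as a *-homomorphism on `B(H) ⊗ B(K)`. -/
noncomputable def opTensorHom :
    (H →L[ℂ] H) ⊗[ℂ] (K →L[ℂ] K) →⋆ₐ[ℂ] (HilbertTensor H K →L[ℂ] HilbertTensor H K) where
  __ := opTensorAlgHom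
  map_star' t := by
    change opTensorAlgHom (star t) = star (opTensorAlgHom t)
    induction t with
    | zero =>
      rw [star_zero, map_zero]
      exact (star_zero (HilbertTensor H K →L[ℂ] HilbertTensor H K)).symm
    | add x y h h' =>
      rw [star_add, map_add, map_add, h, h']
      exact (star_add (opTensorAlgHom x) (opTensorAlgHom y)).symm
    | tmul a b => exact opTensor_star a b

theorem opTensorHom_tmul (a : H →L[ℂ] H) (b : K →L[ℂ] K) :
    opTensorHom (a ⊗ₜ[ℂ] b) = opTensor a b := rfl

end Operators

/-- The algebraic tensor product of *-homomorphisms. -/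
noncomputable def algMap {S S' T T' : Type*} [Ring S] [StarRing S] [Algebra ℂ S] [StarModule ℂ S]
    [Ring T] [StarRing T] [Algebra ℂ T] [StarModule ℂ T]
    [Ring S'] [StarRing S'] [Algebra ℂ S'] [StarModule ℂ S']
    [Ring T'] [StarRing T'] [Algebra ℂ T'] [StarModule ℂ T']
    (f : S →⋆ₐ[ℂ] S') (g : T →⋆ₐ[ℂ] T') : S ⊗[ℂ] T →⋆ₐ[ℂ] S' ⊗[ℂ] T' where
  __ := Algebra.TensorProduct.map f.toAlgHom g.toAlgHom
  map_star' t := by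
    induction t with
    | zero => simp
    | add x y h h' => simp_all
    | tmul a b => exact congrArg₂ (· ⊗ₜ[ℂ] ·) (map_star f a) (map_star g b)

/-- The *-homomorphism `a ⊗ b ↦ f a * g b` for *-homomorphisms with commuting ranges. -/
noncomputable def algProd {S T D : Type*} [Ring S] [StarRing S] [Algebra ℂ S] [StarModule ℂ S]
    [Ring T] [StarRing T] [Algebra ℂ T] [StarModule ℂ T] [Ring D] [StarRing D] [Algebra ℂ D]
    (f : S →⋆ₐ[ℂ] D) (g : T →⋆ₐ[ℂ] D) (h : ∀ a b, Commute (f a) (g b)) :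
    S ⊗[ℂ] T →⋆ₐ[ℂ] D where
  __ := Algebra.TensorProduct.lift f.toAlgHom g.toAlgHom h
  map_star' t := by
    change Algebra.TensorProduct.lift f.toAlgHom g.toAlgHom h (star t) =
      star (Algebra.TensorProduct.lift f.toAlgHom g.toAlgHom h t)
    induction t with
    | zero => simp
    | add x y h h' => rw [star_add, map_add, map_add, star_add, h, h']
    | tmul a b =>
      rw [TensorProduct.star_tmul, Algebra.TensorProduct.lift_tmul,
        Algebra.TensorProduct.lift_tmul, star_mul]
      exact (congrArg₂ (· * ·) (map_star f a) (map_star g b)).trans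
        ((h a b).star_star).eq

theorem algProd_tmul {S T D : Type*} [Ring S] [StarRing S] [Algebra ℂ S] [StarModule ℂ S]
    [Ring T] [StarRing T] [Algebra ℂ T] [StarModule ℂ T] [Ring D] [StarRing D] [Algebra ℂ D]
    (f : S →⋆ₐ[ℂ] D) (g : T →⋆ₐ[ℂ] D) (h : ∀ a b, Commute (f a) (g b)) (a : S) (b : T) :
    algProd f g h (a ⊗ₜ[ℂ] b) = f a * g b :=
  Algebra.TensorProduct.lift_tmul f.toAlgHom g.toAlgHom h a b

/-- The *-homomorphism `a ↦ a ⊗ 1`. -/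
noncomputable def algInl {S T : Type*} [Ring S] [StarRing S] [Algebra ℂ S] [StarModule ℂ S]
    [Ring T] [StarRing T] [Algebra ℂ T] [StarModule ℂ T] : S →⋆ₐ[ℂ] S ⊗[ℂ] T where
  __ := (Algebra.TensorProduct.includeLeft : S →ₐ[ℂ] S ⊗[ℂ] T)
  map_star' a := show (star a ⊗ₜ[ℂ] (1 : T)) = star (a ⊗ₜ[ℂ] (1 : T)) by
    rw [TensorProduct.star_tmul, star_one]

/-- The *-homomorphism `b ↦ 1 ⊗ b`. -/
noncomputable def algInr {S T : Type*} [Ring S] [StarRing S] [Algebra ℂ S] [StarModule ℂ S]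
    [Ring T] [StarRing T] [Algebra ℂ T] [StarModule ℂ T] : T →⋆ₐ[ℂ] S ⊗[ℂ] T where
  __ := (Algebra.TensorProduct.includeRight : T →ₐ[ℂ] S ⊗[ℂ] T)
  map_star' b := show ((1 : S) ⊗ₜ[ℂ] star b) = star ((1 : S) ⊗ₜ[ℂ] b) by
    rw [TensorProduct.star_tmul, star_one]

/-- The tensor product representation `π ⊗ ρ` of `S ⊗ T`, acting on the Hilbert space
tensor product by `a ⊗ b ↦ π a ⊗ ρ b`. -/
noncomputable def Rep.tensor (π : Rep S) (ρ : Rep T) : Rep (S ⊗[ℂ] T) where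
  space := HilbertTensor π.space ρ.space
  hom := opTensorHom.comp (algMap π.hom ρ.hom)

theorem Rep.tensor_tmul (π : Rep S) (ρ : Rep T) (a : S) (b : T) :
    (π.tensor ρ).hom (a ⊗ₜ[ℂ] b) = opTensor (π.hom a) (ρ.hom b) := rfl

end Representations

section States

variable {A : Type u} [CStarAlgebra A]

theorem dual_im_eq_zero (g : StrongDual ℂ A) (hg : ‖g‖ ≤ 1) (h1 : g 1 = 1) {a : A}
    (ha : IsSelfAdjoint a) : (g a).im = 0 := by
  have key (t : ℝ) : ((g a).im + t) ^ 2 ≤ ‖a‖ ^ 2 + t ^ 2 := by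
    let c : A := algebraMap ℂ A (Complex.I * t)
    have hc : g (a + c) = g a + Complex.I * t := by
      simp only [c, map_add, Algebra.algebraMap_eq_smul_one, map_smul, h1, smul_eq_mul, mul_one]
    have hs : star (a + c) * (a + c) = a * a + algebraMap ℂ A ((t : ℂ) ^ 2) := by
      have : star c = -c := by
        simp [c, Algebra.algebraMap_eq_smul_one, star_smul]
      rw [star_add, ha.star_eq, this]
      have hcomm : c * a = a * c := Algebra.commutes _ _
      have hcc : c * c = - algebraMap ℂ A ((t : ℂ) ^ 2) := by
        rw [← map_mul, ← map_neg]; congr 1; ring_nf; simp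
      calc (a + -c) * (a + c) = a * a + a * c - c * a - c * c := by noncomm_ring
        _ = _ := by rw [hcomm, hcc]; abel
    have hn : ‖a + c‖ ^ 2 ≤ ‖a‖ ^ 2 + t ^ 2 := by
      rcases subsingleton_or_nontrivial A with hA | hA
      · have h0 : ‖a + c‖ = 0 := by rw [Subsingleton.elim (a + c) 0, norm_zero]
        rw [h0]; nlinarith [sq_nonneg ‖a‖, sq_nonneg t]
      rw [pow_two, ← CStarRing.norm_star_mul_self, hs]
      refine (norm_add_le _ _).trans ?_
      rw [norm_algebraMap']
      refine add_le_add ((norm_mul_le a a).trans_eq (pow_two _).symm) ?_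
      rw [norm_pow, Complex.norm_real, Real.norm_eq_abs, sq_abs]
    have hle : ‖g (a + c)‖ ≤ ‖a + c‖ := (g.le_of_opNorm_le hg _).trans_eq (one_mul _)
    have him : |(g a).im + t| ≤ ‖g (a + c)‖ := by
      have := Complex.abs_im_le_norm (g (a + c))
      rw [hc] at this ⊢
      simpa using this
    calc ((g a).im + t) ^ 2 = |(g a).im + t| ^ 2 := (sq_abs _).symm
      _ ≤ ‖a + c‖ ^ 2 := by gcongr; exact him.trans hle
      _ ≤ _ := hn
  by_contra hne
  have h := key ((‖a‖ ^ 2 + 1) / (2 * (g a).im))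
  have e : 2 * (g a).im * ((‖a‖ ^ 2 + 1) / (2 * (g a).im)) = ‖a‖ ^ 2 + 1 := by field_simp
  nlinarith [sq_nonneg (g a).im]

variable [PartialOrder A] [StarOrderedRing A]

theorem dual_nonneg (g : StrongDual ℂ A) (hg : ‖g‖ ≤ 1) (h1 : g 1 = 1) {a : A}
    (ha : 0 ≤ a) : 0 ≤ g a := by
  have hsa : IsSelfAdjoint a := IsSelfAdjoint.of_nonneg ha
  have him := dual_im_eq_zero g hg h1 hsa
  have hle : a ≤ algebraMap ℝ A ‖a‖ := hsa.le_algebraMap_norm_self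
  have h2 : ‖algebraMap ℝ A ‖a‖ - a‖ ≤ ‖a‖ := by
    rcases subsingleton_or_nontrivial A with hA | hA
    · rw [Subsingleton.elim (algebraMap ℝ A ‖a‖ - a) 0, norm_zero]; positivity
    refine (CStarAlgebra.norm_le_norm_of_nonneg_of_le (sub_nonneg.mpr hle)
      (sub_le_self _ ha)).trans ?_
    rw [norm_algebraMap']; simp
  have h3 : g (algebraMap ℝ A ‖a‖ - a) = (‖a‖ : ℂ) - g a := by
    have : algebraMap ℝ A ‖a‖ = (‖a‖ : ℂ) • (1 : A) := by
      rw [Algebra.algebraMap_eq_smul_one]; exact (Complex.coe_smul _ _).symm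
    rw [map_sub, this, map_smul, h1, smul_eq_mul, mul_one]
  have h4 : ‖(‖a‖ : ℂ) - g a‖ ≤ ‖a‖ := by
    rw [← h3]; exact ((g.le_of_opNorm_le hg _).trans_eq (one_mul _)).trans h2
  have h5 := (Complex.re_le_norm _).trans h4
  rw [Complex.sub_re, Complex.ofReal_re] at h5
  rw [Complex.nonneg_iff]
  exact ⟨by linarith, him.symm⟩

theorem exists_state [Nontrivial A] {h : A} (hh : 0 ≤ h) :
    ∃ f : A →ₚ[ℂ] ℂ, f 1 = 1 ∧ f h = ‖h‖ := by
  have hsa : IsSelfAdjoint h := IsSelfAdjoint.of_nonneg hh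
  have : IsStarNormal h := hsa.isStarNormal
  let S := StarAlgebra.elemental ℂ h
  have : IsClosed (S : Set A) := StarAlgebra.elemental.isClosed ℂ h
  let x : S := ⟨h, StarAlgebra.elemental.self_mem ℂ h⟩
  have hspec : (‖h‖ : ℂ) ∈ spectrum ℂ x := by
    rw [StarSubalgebra.spectrum_eq]
    have := CStarAlgebra.norm_mem_spectrum_of_nonneg hh
    exact (spectrum.algebraMap_mem_iff ℂ).mpr this
  obtain ⟨χ, hχ⟩ := WeakDual.CharacterSpace.mem_spectrum_iff_exists.mp hspec
  let f0 : StrongDual ℂ S := WeakDual.toStrongDual (χ : WeakDual ℂ S)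
  have hf0 : ‖f0‖ ≤ 1 := ContinuousLinearMap.opNorm_le_bound _ zero_le_one fun y => by
    rw [one_mul]
    exact AlgHom.norm_apply_le_self χ y
  obtain ⟨g, hg, hgn⟩ := exists_extension_norm_eq (S.toSubalgebra.toSubmodule) f0
  have hg1 : g 1 = 1 := (hg (1 : S)).trans (map_one χ)
  have hgh : g h = ‖h‖ := (hg x).trans hχ
  refine ⟨PositiveLinearMap.mk₀ g.toLinearMap fun a ha => ?_, hg1, hgh⟩
  exact dual_nonneg g (hgn.trans_le hf0) hg1 ha

end States

section FaithfulReps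

variable {A : Type u} [CStarAlgebra A]

theorem exists_rep (a : A) : ∃ π : Rep A, ‖a‖ ≤ ‖π.hom a‖ := by
  let _ : PartialOrder A := CStarAlgebra.spectralOrder A
  have : StarOrderedRing A := CStarAlgebra.spectralOrderedRing A
  rcases subsingleton_or_nontrivial A with hA | hA
  · exact ⟨⟨(0 : A →ₚ[ℂ] ℂ).GNS, (0 : A →ₚ[ℂ] ℂ).gnsStarAlgHom⟩, by rw [Subsingleton.elim a 0]; simp⟩
  obtain ⟨f, f1, fa⟩ := exists_state (star_mul_self_nonneg a)
  refine ⟨⟨f.GNS, f.gnsStarAlgHom⟩, ?_⟩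
  let Ω : f.GNS := ((f.toPreGNS 1 : f.PreGNS) : f.GNS)
  have hΩ : ‖Ω‖ = 1 := by
    rw [Completion.norm_coe, PositiveLinearMap.preGNS_norm_def]
    simp [f1]
  have hv : ‖f.gnsStarAlgHom a Ω‖ = ‖a‖ := by
    have : f.gnsStarAlgHom a Ω = ((f.toPreGNS a : f.PreGNS) : f.GNS) := by
      refine (PositiveLinearMap.gnsNonUnitalStarAlgHom_apply_coe f).trans ?_
      simp
    rw [this, Completion.norm_coe, PositiveLinearMap.preGNS_norm_def]
    simp [fa, CStarRing.norm_star_mul_self]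
  have := (f.gnsStarAlgHom a).le_opNorm Ω
  rwa [hv, hΩ, mul_one] at this

end FaithfulReps

section MinTensor

variable {A B C : Type u} [CStarAlgebra A] [CStarAlgebra B] [CStarAlgebra C]

instance : StarModule ℂ (A ⊗[ℂ] B) := inferInstance

instance : StarModule ℂ (A ⊗[ℂ] (B ⊗[ℂ] C)) := inferInstance

theorem Rep.norm_hom_le (π : Rep A) (a : A) : ‖π.hom a‖ ≤ ‖a‖ :=
  NonUnitalStarAlgHom.norm_apply_le π.hom a

theorem bddAbove_tensor (t : A ⊗[ℂ] B) : BddAbove (Set.range fun R : Rep A × Rep B =>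
    (CStarSeminorm.ofHom (R.1.tensor R.2).hom).toSeminorm t) := by
  suffices h : ∃ r : ℝ, ∀ (π : Rep A) (ρ : Rep B), ‖(π.tensor ρ).hom t‖ ≤ r by
    obtain ⟨r, hr⟩ := h
    exact ⟨r, by rintro _ ⟨R, rfl⟩; exact hr R.1 R.2⟩
  induction t with
  | zero => exact ⟨0, fun π ρ => by rw [map_zero, norm_zero]⟩
  | add x y hx hy =>
    obtain ⟨r, hr⟩ := hx
    obtain ⟨s, hs⟩ := hy
    exact ⟨r + s, fun π ρ => by
      rw [map_add]; exact (norm_add_le _ _).trans (add_le_add (hr π ρ) (hs π ρ))⟩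
  | tmul a b =>
    exact ⟨‖a‖ * ‖b‖, fun π ρ => by
      rw [Rep.tensor_tmul]
      exact (norm_opTensor_le _ _).trans (mul_le_mul (π.norm_hom_le a) (ρ.norm_hom_le b)
        (norm_nonneg _) (norm_nonneg _))⟩

variable (A B C) in
/-- The minimal (spatial) C*-norm on `A ⊗ B`: the supremum of `‖(π ⊗ ρ) t‖` over all
representations `π` of `A` and `ρ` of `B` on Hilbert spaces. -/
noncomputable def minNorm : CStarSeminorm (A ⊗[ℂ] B) :=
  CStarSeminorm.iSup (fun R : Rep A × Rep B => CStarSeminorm.ofHom (R.1.tensor R.2).hom)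
    bddAbove_tensor

theorem le_minNorm (π : Rep A) (ρ : Rep B) (t : A ⊗[ℂ] B) :
    ‖(π.tensor ρ).hom t‖ ≤ (minNorm A B).toSeminorm t :=
  le_ciSup (bddAbove_tensor t) (π, ρ)

theorem minNorm_le {t : A ⊗[ℂ] B} {r : ℝ} (hr : 0 ≤ r)
    (h : ∀ (π : Rep A) (ρ : Rep B), ‖(π.tensor ρ).hom t‖ ≤ r) :
    (minNorm A B).toSeminorm t ≤ r :=
  Real.iSup_le (fun R : Rep A × Rep B => h R.1 R.2) hr

variable (A B) in
/-- The minimal C*-tensor product of two C*-algebras. -/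
abbrev MinTensor : Type u := (minNorm A B).CAlg

theorem bddAbove_tensor₃ (t : A ⊗[ℂ] (B ⊗[ℂ] C)) :
    BddAbove (Set.range fun R : Rep A × Rep B × Rep C =>
      (CStarSeminorm.ofHom (R.1.tensor (R.2.1.tensor R.2.2)).hom).toSeminorm t) := by
  suffices h : ∃ r : ℝ, ∀ (π : Rep A) (ρ : Rep B) (σ : Rep C),
      ‖(π.tensor (ρ.tensor σ)).hom t‖ ≤ r by
    obtain ⟨r, hr⟩ := h
    exact ⟨r, by rintro _ ⟨R, rfl⟩; exact hr R.1 R.2.1 R.2.2⟩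
  induction t with
  | zero => exact ⟨0, fun π ρ σ => by rw [map_zero, norm_zero]⟩
  | add x y hx hy =>
    obtain ⟨r, hr⟩ := hx
    obtain ⟨s, hs⟩ := hy
    exact ⟨r + s, fun π ρ σ => by
      rw [map_add]; exact (norm_add_le _ _).trans (add_le_add (hr π ρ σ) (hs π ρ σ))⟩
  | tmul a t =>
    exact ⟨‖a‖ * (minNorm B C).toSeminorm t, fun π ρ σ => by
      rw [Rep.tensor_tmul]
      exact (norm_opTensor_le _ _).trans (mul_le_mul (π.norm_hom_le a) (le_minNorm ρ σ t)
        (norm_nonneg _) (norm_nonneg _))⟩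

variable (A B C) in
/-- The minimal (spatial) C*-norm on `A ⊗ B ⊗ C`. -/
noncomputable def minNorm₃ : CStarSeminorm (A ⊗[ℂ] (B ⊗[ℂ] C)) :=
  CStarSeminorm.iSup (fun R : Rep A × Rep B × Rep C =>
    CStarSeminorm.ofHom (R.1.tensor (R.2.1.tensor R.2.2)).hom) bddAbove_tensor₃

theorem le_minNorm₃ (π : Rep A) (ρ : Rep B) (σ : Rep C) (t : A ⊗[ℂ] (B ⊗[ℂ] C)) :
    ‖(π.tensor (ρ.tensor σ)).hom t‖ ≤ (minNorm₃ A B C).toSeminorm t :=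
  le_ciSup (bddAbove_tensor₃ t) (π, ρ, σ)

theorem minNorm₃_le {t : A ⊗[ℂ] (B ⊗[ℂ] C)} {r : ℝ} (hr : 0 ≤ r)
    (h : ∀ (π : Rep A) (ρ : Rep B) (σ : Rep C), ‖(π.tensor (ρ.tensor σ)).hom t‖ ≤ r) :
    (minNorm₃ A B C).toSeminorm t ≤ r :=
  Real.iSup_le (fun R : Rep A × Rep B × Rep C => h R.1 R.2.1 R.2.2) hr

variable (A B C) in
/-- The minimal C*-tensor product of three C*-algebras. -/
abbrev MinTensor₃ : Type u := (minNorm₃ A B C).CAlg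

/-- The elementary tensor `a ⊗ b` in the minimal tensor product. -/
noncomputable def MinTensor.tmul (a : A) (b : B) : MinTensor A B := (minNorm A B).incl (a ⊗ₜ[ℂ] b)

/-- The representation `π ⊗ ρ` of the minimal tensor product. -/
noncomputable def Rep.minTensor (π : Rep A) (ρ : Rep B) : Rep (MinTensor A B) where
  space := (π.tensor ρ).space
  hom := (minNorm A B).lift (π.tensor ρ).hom (le_minNorm π ρ)

theorem Rep.minTensor_incl (π : Rep A) (ρ : Rep B) (t : A ⊗[ℂ] B) :
    (π.minTensor ρ).hom ((minNorm A B).incl t) = (π.tensor ρ).hom t :=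
  (minNorm A B).lift_incl _ (le_minNorm π ρ) t

/-- The representation `π ⊗ ρ ⊗ σ` of the minimal tensor product. -/
noncomputable def Rep.minTensor₃ (π : Rep A) (ρ : Rep B) (σ : Rep C) :
    Rep (MinTensor₃ A B C) where
  space := (π.tensor (ρ.tensor σ)).space
  hom := (minNorm₃ A B C).lift (π.tensor (ρ.tensor σ)).hom (le_minNorm₃ π ρ σ)

theorem Rep.minTensor₃_incl (π : Rep A) (ρ : Rep B) (σ : Rep C) (t : A ⊗[ℂ] (B ⊗[ℂ] C)) :
    (π.minTensor₃ ρ σ).hom ((minNorm₃ A B C).incl t) = (π.tensor (ρ.tensor σ)).hom t :=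
  (minNorm₃ A B C).lift_incl _ (le_minNorm₃ π ρ σ) t

/-- Pulling back a representation along a *-homomorphism. -/
noncomputable def Rep.pullback {S T : Type u} [Ring S] [StarRing S] [Algebra ℂ S]
    [Ring T] [StarRing T] [Algebra ℂ T] (π : Rep T) (f : S →⋆ₐ[ℂ] T) : Rep S where
  space := π.space
  hom := π.hom.comp f

theorem algHom_ext_tmul {S T D : Type u} [Ring S] [StarRing S] [Algebra ℂ S] [StarModule ℂ S]
    [Ring T] [StarRing T] [Algebra ℂ T] [StarModule ℂ T] [Ring D] [StarRing D] [Algebra ℂ D]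
    {f g : S ⊗[ℂ] T →⋆ₐ[ℂ] D} (h : ∀ a b, f (a ⊗ₜ b) = g (a ⊗ₜ b)) (t : S ⊗[ℂ] T) :
    f t = g t := by
  induction t with
  | zero => rw [map_zero, map_zero]
  | add x y hx hy => rw [map_add, map_add, hx, hy]
  | tmul a b => exact h a b

theorem Rep.tensor_pullback {A' B' : Type u} [CStarAlgebra A'] [CStarAlgebra B']
    (π : Rep A') (ρ : Rep B') (f : A →⋆ₐ[ℂ] A') (g : B →⋆ₐ[ℂ] B') (t : A ⊗[ℂ] B) :
    (π.tensor ρ).hom (algMap f g t) = ((π.pullback f).tensor (ρ.pullback g)).hom t :=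
  algHom_ext_tmul (f := (π.tensor ρ).hom.comp (algMap f g))
    (g := ((π.pullback f).tensor (ρ.pullback g)).hom) (fun _ _ => rfl) t

theorem norm_algMap_le {A' B' : Type u} [CStarAlgebra A'] [CStarAlgebra B']
    (f : A →⋆ₐ[ℂ] A') (g : B →⋆ₐ[ℂ] B') (t : A ⊗[ℂ] B) :
    ‖((minNorm A' B').incl.comp (algMap f g)) t‖ ≤ (minNorm A B).toSeminorm t := by
  refine ((minNorm A' B').norm_incl _).trans_le ?_
  refine minNorm_le (apply_nonneg _ _) fun π ρ => ?_
  exact (congrArg norm (Rep.tensor_pullback π ρ f g t)).trans_le (le_minNorm _ _ t)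

/-- The *-homomorphism `f ⊗ g` between minimal tensor products. -/
noncomputable def MinTensor.map {A' B' : Type u} [CStarAlgebra A'] [CStarAlgebra B']
    (f : A →⋆ₐ[ℂ] A') (g : B →⋆ₐ[ℂ] B') : MinTensor A B →⋆ₐ[ℂ] MinTensor A' B' :=
  (minNorm A B).lift ((minNorm A' B').incl.comp (algMap f g)) (norm_algMap_le f g)

theorem MinTensor.map_tmul {A' B' : Type u} [CStarAlgebra A'] [CStarAlgebra B']
    (f : A →⋆ₐ[ℂ] A') (g : B →⋆ₐ[ℂ] B') (a : A) (b : B) :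
    MinTensor.map f g (MinTensor.tmul a b) = MinTensor.tmul (f a) (g b) :=
  (minNorm A B).lift_incl _ (norm_algMap_le f g) _

end MinTensor

section Slices

theorem norm_le_opTensor_left {H : Type u} [NormedAddCommGroup H] [InnerProductSpace ℂ H]
    (a : H →L[ℂ] H) : ‖a‖ ≤ ‖opTensor a (1 : H →L[ℂ] H)‖ := by
  refine ContinuousLinearMap.opNorm_le_bound a (norm_nonneg (opTensor _ _)) fun v => ?_
  rcases eq_or_ne v 0 with rfl | hv
  · simp
  have h := (opTensor a (1 : H →L[ℂ] H)).le_opNorm ((v ⊗ₜ[ℂ] v : H ⊗[ℂ] H) : HilbertTensor H H)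
  rw [opTensor_coe, Completion.norm_coe, Completion.norm_coe, TensorProduct.mapL_tmul,
    TensorProduct.norm_tmul, TensorProduct.norm_tmul, ← mul_assoc] at h
  exact le_of_mul_le_mul_right h (norm_pos_iff.mpr hv)

theorem norm_le_opTensor_right {H : Type u} [NormedAddCommGroup H] [InnerProductSpace ℂ H]
    (a : H →L[ℂ] H) : ‖a‖ ≤ ‖opTensor (1 : H →L[ℂ] H) a‖ := by
  refine ContinuousLinearMap.opNorm_le_bound a (norm_nonneg (opTensor _ _)) fun v => ?_
  rcases eq_or_ne v 0 with rfl | hv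
  · simp
  have h := (opTensor (1 : H →L[ℂ] H) a).le_opNorm ((v ⊗ₜ[ℂ] v : H ⊗[ℂ] H) : HilbertTensor H H)
  rw [opTensor_coe, Completion.norm_coe, Completion.norm_coe, TensorProduct.mapL_tmul,
    TensorProduct.norm_tmul, TensorProduct.norm_tmul, mul_left_comm] at h
  exact le_of_mul_le_mul_left h (norm_pos_iff.mpr hv)

variable {A B : Type u} [CStarAlgebra A] [CStarAlgebra B]

/-- The scalar representation `b ↦ χ b • 1` on `H` attached to a character `χ`. -/
noncomputable def charRep (χ : B →⋆ₐ[ℂ] ℂ) (H : Type u) [NormedAddCommGroup H]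
    [InnerProductSpace ℂ H] [CompleteSpace H] : Rep B where
  space := H
  hom := (StarAlgHom.ofId ℂ (H →L[ℂ] H)).comp χ

/-- The map `a ⊗ b ↦ χ b • a` on the algebraic tensor product. -/
noncomputable def algSliceRight (χ : B →⋆ₐ[ℂ] ℂ) : A ⊗[ℂ] B →⋆ₐ[ℂ] A :=
  algProd (StarAlgHom.id ℂ A) ((StarAlgHom.ofId ℂ A).comp χ)
    fun a b => (Algebra.commutes (χ b) a).symm

/-- The map `a ⊗ b ↦ χ a • b` on the algebraic tensor product. -/
noncomputable def algSliceLeft (χ : A →⋆ₐ[ℂ] ℂ) : A ⊗[ℂ] B →⋆ₐ[ℂ] B :=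
  algProd ((StarAlgHom.ofId ℂ B).comp χ) (StarAlgHom.id ℂ B)
    fun a b => Algebra.commutes (χ a) b

theorem algSliceRight_tmul (χ : B →⋆ₐ[ℂ] ℂ) (a : A) (b : B) :
    algSliceRight χ (a ⊗ₜ[ℂ] b) = χ b • a :=
  (algProd_tmul (StarAlgHom.id ℂ A) ((StarAlgHom.ofId ℂ A).comp χ)
    (fun a b => (Algebra.commutes (χ b) a).symm) a b).trans
    ((Algebra.commutes (χ b) a).symm.trans (Algebra.smul_def _ _).symm)

theorem algSliceLeft_tmul (χ : A →⋆ₐ[ℂ] ℂ) (a : A) (b : B) :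
    algSliceLeft χ (a ⊗ₜ[ℂ] b) = χ a • b :=
  (algProd_tmul ((StarAlgHom.ofId ℂ B).comp χ) (StarAlgHom.id ℂ B)
    (fun a b => Algebra.commutes (χ a) b) a b).trans (Algebra.smul_def _ _).symm

theorem opTensor_algSliceRight (χ : B →⋆ₐ[ℂ] ℂ) (π : Rep A) (t : A ⊗[ℂ] B) :
    opTensor (π.hom (algSliceRight χ t)) (1 : π.space →L[ℂ] π.space) =
      (π.tensor (charRep χ π.space)).hom t := by
  induction t with
  | zero => simp only [map_zero]; exact LinearMap.map_zero₂ opTensorBilin _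
  | add x y hx hy =>
    rw [map_add, map_add, map_add, ← hx, ← hy]
    exact LinearMap.map_add₂ opTensorBilin _ _ _
  | tmul a b =>
    rw [algSliceRight_tmul, map_smul]
    refine (LinearMap.map_smul₂ opTensorBilin _ _ _).trans
      (((opTensorBilin (π.hom a)).map_smul (χ b) 1).symm.trans ?_)
    exact congrArg (opTensor (π.hom a)) (Algebra.algebraMap_eq_smul_one (χ b)).symm

theorem opTensor_algSliceLeft (χ : A →⋆ₐ[ℂ] ℂ) (ρ : Rep B) (t : A ⊗[ℂ] B) :
    opTensor (1 : ρ.space →L[ℂ] ρ.space) (ρ.hom (algSliceLeft χ t)) =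
      ((charRep χ ρ.space).tensor ρ).hom t := by
  induction t with
  | zero => simp only [map_zero]; exact (opTensorBilin _).map_zero
  | add x y hx hy =>
    rw [map_add, map_add, map_add, ← hx, ← hy]
    exact (opTensorBilin _).map_add _ _
  | tmul a b =>
    rw [algSliceLeft_tmul, map_smul]
    refine ((opTensorBilin _).map_smul _ _).trans
      ((LinearMap.map_smul₂ opTensorBilin (χ a) 1 (ρ.hom b)).symm.trans ?_)
    exact congrArg (fun T => opTensor T (ρ.hom b)) (Algebra.algebraMap_eq_smul_one (χ a)).symm

theorem norm_algSliceRight_le (χ : B →⋆ₐ[ℂ] ℂ) (t : A ⊗[ℂ] B) :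
    ‖algSliceRight χ t‖ ≤ (minNorm A B).toSeminorm t := by
  obtain ⟨π, hπ⟩ := exists_rep (algSliceRight χ t)
  refine hπ.trans ((norm_le_opTensor_left _).trans (le_trans (le_of_eq ?_)
    (le_minNorm π (charRep χ π.space) t)))
  exact congrArg norm (opTensor_algSliceRight χ π t)

theorem norm_algSliceLeft_le (χ : A →⋆ₐ[ℂ] ℂ) (t : A ⊗[ℂ] B) :
    ‖algSliceLeft χ t‖ ≤ (minNorm A B).toSeminorm t := by
  obtain ⟨ρ, hρ⟩ := exists_rep (algSliceLeft χ t)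
  refine hρ.trans ((norm_le_opTensor_right _).trans (le_trans (le_of_eq ?_)
    (le_minNorm (charRep χ ρ.space) ρ t)))
  exact congrArg norm (opTensor_algSliceLeft χ ρ t)

/-- The slice map `id ⊗ χ : A ⊗ B → A` of a character `χ`. -/
noncomputable def MinTensor.sliceRight (χ : B →⋆ₐ[ℂ] ℂ) : MinTensor A B →⋆ₐ[ℂ] A :=
  (minNorm A B).lift (algSliceRight χ) (norm_algSliceRight_le χ)

/-- The slice map `χ ⊗ id : A ⊗ B → B` of a character `χ`. -/
noncomputable def MinTensor.sliceLeft (χ : A →⋆ₐ[ℂ] ℂ) : MinTensor A B →⋆ₐ[ℂ] B :=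
  (minNorm A B).lift (algSliceLeft χ) (norm_algSliceLeft_le χ)

theorem MinTensor.sliceRight_tmul (χ : B →⋆ₐ[ℂ] ℂ) (a : A) (b : B) :
    MinTensor.sliceRight χ (MinTensor.tmul a b) = χ b • a :=
  ((minNorm A B).lift_incl _ (norm_algSliceRight_le χ) _).trans (algSliceRight_tmul χ a b)

theorem MinTensor.sliceLeft_tmul (χ : A →⋆ₐ[ℂ] ℂ) (a : A) (b : B) :
    MinTensor.sliceLeft χ (MinTensor.tmul a b) = χ a • b :=
  ((minNorm A B).lift_incl _ (norm_algSliceLeft_le χ) _).trans (algSliceLeft_tmul χ a b)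

end Slices

section Assoc

variable {A B C : Type u} [CStarAlgebra A] [CStarAlgebra B] [CStarAlgebra C]

theorem CStarSeminorm.norm_le_of_forall {T : Type u} [Ring T] [StarRing T] [Algebra ℂ T]
    [StarModule ℂ T] (p : CStarSeminorm T) {ι : Type*} (D : ι → Type*)
    [∀ i, CStarAlgebra (D i)] (G : ∀ i, p.CAlg →⋆ₐ[ℂ] D i)
    (hp : ∀ x r, 0 ≤ r → (∀ i, ‖G i (p.incl x)‖ ≤ r) → p.toSeminorm x ≤ r)
    (y : p.CAlg) (r : ℝ) (hr : 0 ≤ r) (h : ∀ i, ‖G i y‖ ≤ r) : ‖y‖ ≤ r := by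
  refine le_of_forall_pos_le_add fun ε hε => ?_
  obtain ⟨x, hx⟩ := p.denseRange_incl.exists_dist_lt y (half_pos hε)
  rw [dist_eq_norm] at hx
  have h1 : ‖p.incl x‖ ≤ r + ε / 2 := by
    rw [p.norm_incl]
    refine hp x _ (by positivity) fun i => ?_
    have h2 : ‖G i (y - p.incl x)‖ ≤ ε / 2 :=
      (NonUnitalStarAlgHom.norm_apply_le (G i) _).trans hx.le
    have h3 : G i (p.incl x) = G i y - G i (y - p.incl x) := by rw [map_sub]; abel
    rw [h3]
    exact (norm_sub_le _ _).trans (add_le_add (h i) h2)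
  have h4 : y = p.incl x + (y - p.incl x) := by abel
  rw [h4]
  exact (norm_add_le _ _).trans (by linarith)

theorem norm_le_minTensor₃ (y : MinTensor₃ A B C) (r : ℝ) (hr : 0 ≤ r)
    (h : ∀ (π : Rep A) (ρ : Rep B) (σ : Rep C), ‖(π.minTensor₃ ρ σ).hom y‖ ≤ r) : ‖y‖ ≤ r :=
  (minNorm₃ A B C).norm_le_of_forall (ι := Rep A × Rep B × Rep C) _
    (fun R => (R.1.minTensor₃ R.2.1 R.2.2).hom)
    (fun x r hr hx => minNorm₃_le hr fun π ρ σ => by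
      rw [← Rep.minTensor₃_incl]; exact hx (π, ρ, σ)) y r hr fun R => h _ _ _

theorem minNorm₃_algMap_inl_le (t : A ⊗[ℂ] B) :
    ‖((minNorm₃ A B C).incl.comp (algMap (StarAlgHom.id ℂ A) algInl)) t‖ ≤
      (minNorm A B).toSeminorm t := by
  refine ((minNorm₃ A B C).norm_incl _).trans_le ?_
  refine minNorm₃_le (apply_nonneg _ _) fun π ρ σ => ?_
  refine (congrArg norm ?_).trans_le (le_minNorm π ((ρ.tensor σ).pullback algInl) t)
  exact algHom_ext_tmul (f := (π.tensor (ρ.tensor σ)).hom.comp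
      (algMap (StarAlgHom.id ℂ A) algInl))
    (g := (π.tensor ((ρ.tensor σ).pullback algInl)).hom) (fun _ _ => rfl) t

theorem minNorm₃_inr_le (t : B ⊗[ℂ] C) :
    ‖((minNorm₃ A B C).incl.comp algInr) t‖ ≤ (minNorm B C).toSeminorm t := by
  refine ((minNorm₃ A B C).norm_incl _).trans_le ?_
  refine minNorm₃_le (apply_nonneg _ _) fun π ρ σ => ?_
  refine (norm_opTensor_le (π.hom 1) ((ρ.tensor σ).hom t)).trans ?_
  rw [map_one]
  refine (mul_le_mul_of_nonneg_right (ContinuousLinearMap.norm_id_le) (norm_nonneg _)).trans ?_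
  rw [one_mul]
  exact le_minNorm ρ σ t

/-- The embedding `a ⊗ b ↦ a ⊗ b ⊗ 1`. -/
noncomputable def MinTensor.incl₁₂ : MinTensor A B →⋆ₐ[ℂ] MinTensor₃ A B C :=
  (minNorm A B).lift ((minNorm₃ A B C).incl.comp (algMap (StarAlgHom.id ℂ A) algInl))
    minNorm₃_algMap_inl_le

/-- The embedding `b ⊗ c ↦ 1 ⊗ b ⊗ c`. -/
noncomputable def MinTensor.incl₂₃ : MinTensor B C →⋆ₐ[ℂ] MinTensor₃ A B C :=
  (minNorm B C).lift ((minNorm₃ A B C).incl.comp algInr) minNorm₃_inr_le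

/-- The embedding `a ↦ a ⊗ 1 ⊗ 1`. -/
noncomputable def MinTensor.incl₁ : A →⋆ₐ[ℂ] MinTensor₃ A B C :=
  (minNorm₃ A B C).incl.comp algInl

/-- The embedding `c ↦ 1 ⊗ 1 ⊗ c`. -/
noncomputable def MinTensor.incl₃ : C →⋆ₐ[ℂ] MinTensor₃ A B C :=
  (minNorm₃ A B C).incl.comp (algInr.comp algInr)

theorem MinTensor.incl₁₂_incl (t : A ⊗[ℂ] B) :
    MinTensor.incl₁₂ (C := C) ((minNorm A B).incl t) =
      (minNorm₃ A B C).incl (algMap (StarAlgHom.id ℂ A) algInl t) :=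
  (minNorm A B).lift_incl _ minNorm₃_algMap_inl_le t

theorem MinTensor.incl₂₃_incl (t : B ⊗[ℂ] C) :
    MinTensor.incl₂₃ (A := A) ((minNorm B C).incl t) = (minNorm₃ A B C).incl (1 ⊗ₜ t) :=
  (minNorm B C).lift_incl _ minNorm₃_inr_le t

theorem starAlgHom_continuous {D D' : Type*} [CStarAlgebra D] [CStarAlgebra D']
    (f : D →⋆ₐ[ℂ] D') : Continuous f :=
  AddMonoidHomClass.continuous_of_bound f 1 fun x => by
    rw [one_mul]; exact NonUnitalStarAlgHom.norm_apply_le f x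

theorem MinTensor.commute_right (a : A) (y : MinTensor B C) :
    Commute (MinTensor.incl₁ (B := B) (C := C) a) (MinTensor.incl₂₃ y) := by
  refine (minNorm B C).denseRange_incl.induction_on
    (p := fun y => Commute (MinTensor.incl₁ (B := B) (C := C) a) (MinTensor.incl₂₃ y)) y ?_ ?_
  · exact isClosed_eq (continuous_const.mul (starAlgHom_continuous _))
      ((starAlgHom_continuous _).mul continuous_const)
  · intro t
    rw [MinTensor.incl₂₃_incl]
    refine Commute.map (f := (minNorm₃ A B C).incl) (x := algInl a) (y := 1 ⊗ₜ t) ?_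
    exact (Algebra.TensorProduct.tmul_mul_tmul _ _ _ _).trans
      ((congrArg₂ (· ⊗ₜ[ℂ] ·) (Commute.one_right a).eq (Commute.one_left t).eq).trans
        (Algebra.TensorProduct.tmul_mul_tmul _ _ _ _).symm)

theorem algMap_inl_commute (t : A ⊗[ℂ] B) (c : C) :
    Commute (algMap (StarAlgHom.id ℂ A) (algInl (T := C)) t)
      ((1 : A) ⊗ₜ[ℂ] ((1 : B) ⊗ₜ[ℂ] c)) := by
  induction t with
  | zero => rw [map_zero]; exact Commute.zero_left _
  | add x y hx hy => rw [map_add]; exact hx.add_left hy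
  | tmul a b =>
    change (a ⊗ₜ[ℂ] (b ⊗ₜ[ℂ] (1 : C))) * (1 ⊗ₜ[ℂ] (1 ⊗ₜ[ℂ] c)) =
      (1 ⊗ₜ[ℂ] (1 ⊗ₜ[ℂ] c)) * (a ⊗ₜ[ℂ] (b ⊗ₜ[ℂ] (1 : C)))
    simp only [Algebra.TensorProduct.tmul_mul_tmul, mul_one, one_mul]

theorem MinTensor.commute_left (y : MinTensor A B) (c : C) :
    Commute (MinTensor.incl₁₂ y) (MinTensor.incl₃ (A := A) (B := B) c) := by
  have hc : Continuous (MinTensor.incl₁₂ : MinTensor A B →⋆ₐ[ℂ] MinTensor₃ A B C) :=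
    starAlgHom_continuous _
  refine (minNorm A B).denseRange_incl.induction_on
    (p := fun y => Commute (MinTensor.incl₁₂ y) (MinTensor.incl₃ (A := A) (B := B) c)) y ?_ ?_
  · exact isClosed_eq (hc.mul continuous_const) (continuous_const.mul hc)
  · intro t
    rw [MinTensor.incl₁₂_incl]
    exact (algMap_inl_commute t c).map (minNorm₃ A B C).incl

/-- `a ⊗ y ↦ a ⊗ y` on the algebraic tensor product of `A` with `B ⊗ C`. -/
noncomputable def algAssocRight : A ⊗[ℂ] MinTensor B C →⋆ₐ[ℂ] MinTensor₃ A B C :=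
  algProd MinTensor.incl₁ MinTensor.incl₂₃ MinTensor.commute_right

/-- `y ⊗ c ↦ y ⊗ c` on the algebraic tensor product of `A ⊗ B` with `C`. -/
noncomputable def algAssocLeft : MinTensor A B ⊗[ℂ] C →⋆ₐ[ℂ] MinTensor₃ A B C :=
  algProd MinTensor.incl₁₂ MinTensor.incl₃ MinTensor.commute_left

end Assoc

section HilbertAssoc

variable (H K L : Type u) [NormedAddCommGroup H] [InnerProductSpace ℂ H]
  [NormedAddCommGroup K] [InnerProductSpace ℂ K] [NormedAddCommGroup L] [InnerProductSpace ℂ L]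

/-- The dense inclusion of the algebraic tensor product `(H ⊗ K) ⊗ L`. -/
noncomputable def hilbertInclLeft :
    (H ⊗[ℂ] K) ⊗[ℂ] L →ₗᵢ[ℂ] HilbertTensor (HilbertTensor H K) L :=
  Completion.toComplₗᵢ.comp
    (TensorProduct.mapIsometry (Completion.toComplₗᵢ : H ⊗[ℂ] K →ₗᵢ[ℂ] _) LinearIsometry.id)

/-- The dense inclusion of the algebraic tensor product `H ⊗ (K ⊗ L)`. -/
noncomputable def hilbertInclRight :
    H ⊗[ℂ] (K ⊗[ℂ] L) →ₗᵢ[ℂ] HilbertTensor H (HilbertTensor K L) :=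
  Completion.toComplₗᵢ.comp
    (TensorProduct.mapIsometry LinearIsometry.id (Completion.toComplₗᵢ : K ⊗[ℂ] L →ₗᵢ[ℂ] _))

variable {H K L}

theorem hilbertInclLeft_tmul (v : H ⊗[ℂ] K) (l : L) :
    hilbertInclLeft H K L (v ⊗ₜ l) =
      (((v : HilbertTensor H K) ⊗ₜ[ℂ] l : HilbertTensor H K ⊗[ℂ] L) : HilbertTensor _ _) := rfl

theorem hilbertInclRight_tmul (h : H) (v : K ⊗[ℂ] L) :
    hilbertInclRight H K L (h ⊗ₜ v) =
      ((h ⊗ₜ[ℂ] (v : HilbertTensor K L) : H ⊗[ℂ] HilbertTensor K L) : HilbertTensor _ _) := rfl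

theorem denseRange_of_tmul {M : Type u} {N : Type u} [NormedAddCommGroup M]
    [InnerProductSpace ℂ M] [NormedAddCommGroup N] [InnerProductSpace ℂ N] {V : Type u}
    [AddCommGroup V] [Module ℂ V] (f : V →ₗ[ℂ] HilbertTensor M N)
    (h : ∀ (m : M) (n : N),
      ((m ⊗ₜ[ℂ] n : M ⊗[ℂ] N) : HilbertTensor M N) ∈ closure (Set.range f)) :
    DenseRange f := by
  have hS : ∀ t : M ⊗[ℂ] N, (t : HilbertTensor M N) ∈ (LinearMap.range f).topologicalClosure := by
    intro t
    induction t with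
    | zero => exact Submodule.zero_mem _
    | add x y hx hy => rw [Completion.coe_add]; exact Submodule.add_mem _ hx hy
    | tmul m n => exact h m n
  intro x
  refine Completion.induction_on x ?_ hS
  exact (LinearMap.range f).isClosed_topologicalClosure

theorem denseRange_hilbertInclLeft : DenseRange (hilbertInclLeft H K L).toLinearMap := by
  refine denseRange_of_tmul _ fun m l => ?_
  refine Completion.induction_on m ?_ fun v => ?_
  · refine isClosed_closure.preimage ?_
    exact (Completion.continuous_coe _).comp
      (TensorProduct.continuous_tmul.comp (continuous_id.prodMk continuous_const))
  · exact subset_closure ⟨v ⊗ₜ l, rfl⟩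

theorem denseRange_hilbertInclRight : DenseRange (hilbertInclRight H K L).toLinearMap := by
  refine denseRange_of_tmul _ fun h m => ?_
  refine Completion.induction_on m ?_ fun v => ?_
  · refine isClosed_closure.preimage ?_
    exact (Completion.continuous_coe _).comp
      (TensorProduct.continuous_tmul.comp (continuous_const.prodMk continuous_id))
  · exact subset_closure ⟨h ⊗ₜ v, rfl⟩

variable (H K L) in
/-- The canonical unitary from `(H ⊗ K) ⊗ L` onto `H ⊗ (K ⊗ L)`. -/
noncomputable def hilbertAssoc :
    HilbertTensor (HilbertTensor H K) L ≃ₗᵢ[ℂ] HilbertTensor H (HilbertTensor K L) :=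
  (TensorProduct.assoc ℂ H K L).extendOfIsometry (hilbertInclLeft H K L).toLinearMap
    (hilbertInclRight H K L).toLinearMap denseRange_hilbertInclLeft denseRange_hilbertInclRight
    (fun x => ((hilbertInclRight H K L).norm_map _).trans
      (((TensorProduct.assocIsometry ℂ H K L).norm_map x).trans
        ((hilbertInclLeft H K L).norm_map x).symm))

theorem hilbertAssoc_incl (v : (H ⊗[ℂ] K) ⊗[ℂ] L) :
    hilbertAssoc H K L (hilbertInclLeft H K L v) =
      hilbertInclRight H K L (TensorProduct.assoc ℂ H K L v) :=
  LinearMap.extendOfNorm_eq denseRange_hilbertInclLeft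
    ⟨1, fun x => by
      rw [one_mul]
      exact (((hilbertInclRight H K L).norm_map _).trans
      (((TensorProduct.assocIsometry ℂ H K L).norm_map x).trans
        ((hilbertInclLeft H K L).norm_map x).symm)).le⟩ v

theorem hilbertAssoc_opTensor (a : H →L[ℂ] H) (b : K →L[ℂ] K) (c : L →L[ℂ] L)
    (w : HilbertTensor (HilbertTensor H K) L) :
    hilbertAssoc H K L (opTensor (opTensor a b) c w) =
      opTensor a (opTensor b c) (hilbertAssoc H K L w) := by
  refine denseRange_hilbertInclLeft.induction_on
    (p := fun w => hilbertAssoc H K L (opTensor (opTensor a b) c w) =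
      opTensor a (opTensor b c) (hilbertAssoc H K L w)) w ?_ fun v => ?_
  · exact isClosed_eq ((hilbertAssoc H K L).continuous.comp (opTensor _ c).continuous)
      ((opTensor a _).continuous.comp (hilbertAssoc H K L).continuous)
  · change hilbertAssoc H K L (opTensor (opTensor a b) c (hilbertInclLeft H K L v)) =
      opTensor a (opTensor b c) (hilbertAssoc H K L (hilbertInclLeft H K L v))
    induction v with
    | zero => rw [(hilbertInclLeft H K L).map_zero, map_zero, (hilbertAssoc H K L).map_zero, map_zero]
    | add x y hx hy => simp only [map_add, hx, hy]
    | tmul v l =>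
      induction v with
      | zero =>
        rw [TensorProduct.zero_tmul, (hilbertInclLeft H K L).map_zero, map_zero,
          (hilbertAssoc H K L).map_zero, map_zero]
      | add x y hx hy => simp only [TensorProduct.add_tmul, map_add, hx, hy]
      | tmul h k =>
        have e1 : opTensor (opTensor a b) c (hilbertInclLeft H K L ((h ⊗ₜ k) ⊗ₜ l)) =
            hilbertInclLeft H K L ((a h ⊗ₜ b k) ⊗ₜ c l) := by
          rw [hilbertInclLeft_tmul, hilbertInclLeft_tmul, opTensor_coe, TensorProduct.mapL_tmul,
            opTensor_coe, TensorProduct.mapL_tmul]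
        have e2 : opTensor a (opTensor b c) (hilbertInclRight H K L (h ⊗ₜ (k ⊗ₜ l))) =
            hilbertInclRight H K L (a h ⊗ₜ (b k ⊗ₜ c l)) := by
          rw [hilbertInclRight_tmul, hilbertInclRight_tmul, opTensor_coe, TensorProduct.mapL_tmul,
            opTensor_coe, TensorProduct.mapL_tmul]
        rw [e1, hilbertAssoc_incl, hilbertAssoc_incl, TensorProduct.assoc_tmul,
          TensorProduct.assoc_tmul, e2]

theorem norm_le_of_intertwine (S : HilbertTensor (HilbertTensor H K) L →L[ℂ]
      HilbertTensor (HilbertTensor H K) L)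
    (T : HilbertTensor H (HilbertTensor K L) →L[ℂ] HilbertTensor H (HilbertTensor K L))
    (h : ∀ w, hilbertAssoc H K L (S w) = T (hilbertAssoc H K L w)) : ‖T‖ ≤ ‖S‖ := by
  refine ContinuousLinearMap.opNorm_le_bound T (norm_nonneg S) fun x => ?_
  obtain ⟨w, rfl⟩ := (hilbertAssoc H K L).surjective x
  rw [← h, LinearIsometryEquiv.norm_map, LinearIsometryEquiv.norm_map]
  exact S.le_opNorm w

end HilbertAssoc

section Assoc

variable {A B C : Type u} [CStarAlgebra A] [CStarAlgebra B] [CStarAlgebra C]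

theorem continuous_opTensor_left {H K : Type u} [NormedAddCommGroup H] [InnerProductSpace ℂ H]
    [NormedAddCommGroup K] [InnerProductSpace ℂ K] (b : K →L[ℂ] K) :
    Continuous fun a : H →L[ℂ] H => opTensor a b :=
  AddMonoidHomClass.continuous_of_bound
    (opTensorBilin.flip b : (H →L[ℂ] H) →ₗ[ℂ] (HilbertTensor H K →L[ℂ] HilbertTensor H K)) ‖b‖
    fun a => (norm_opTensor_le a b).trans_eq (mul_comm _ _)

theorem continuous_opTensor_right {H K : Type u} [NormedAddCommGroup H] [InnerProductSpace ℂ H]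
    [NormedAddCommGroup K] [InnerProductSpace ℂ K] (a : H →L[ℂ] H) :
    Continuous fun b : K →L[ℂ] K => opTensor a b :=
  AddMonoidHomClass.continuous_of_bound
    (opTensorBilin a : (K →L[ℂ] K) →ₗ[ℂ] (HilbertTensor H K →L[ℂ] HilbertTensor H K)) ‖a‖
    fun b => norm_opTensor_le a b

theorem algAssocRight_tmul (a : A) (y : MinTensor B C) :
    algAssocRight (a ⊗ₜ[ℂ] y) = MinTensor.incl₁ a * MinTensor.incl₂₃ y :=
  algProd_tmul _ _ MinTensor.commute_right a y

theorem algAssocLeft_tmul (y : MinTensor A B) (c : C) :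
    algAssocLeft (y ⊗ₜ[ℂ] c) = MinTensor.incl₁₂ y * MinTensor.incl₃ c :=
  algProd_tmul _ _ MinTensor.commute_left y c

theorem algAssocRight_incl (a : A) (t : B ⊗[ℂ] C) :
    algAssocRight (a ⊗ₜ[ℂ] (minNorm B C).incl t) = (minNorm₃ A B C).incl (a ⊗ₜ t) := by
  rw [algAssocRight_tmul, MinTensor.incl₂₃_incl]
  refine ((map_mul (minNorm₃ A B C).incl (a ⊗ₜ 1) (1 ⊗ₜ t)).symm).trans ?_
  rw [Algebra.TensorProduct.tmul_mul_tmul, mul_one, one_mul]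

theorem algAssocLeft_incl (a : A) (b : B) (c : C) :
    algAssocLeft ((minNorm A B).incl (a ⊗ₜ[ℂ] b) ⊗ₜ[ℂ] c) =
      (minNorm₃ A B C).incl (a ⊗ₜ (b ⊗ₜ c)) := by
  rw [algAssocLeft_tmul, MinTensor.incl₁₂_incl]
  refine ((map_mul (minNorm₃ A B C).incl (a ⊗ₜ (b ⊗ₜ 1)) (1 ⊗ₜ (1 ⊗ₜ c))).symm).trans ?_
  rw [Algebra.TensorProduct.tmul_mul_tmul, Algebra.TensorProduct.tmul_mul_tmul, mul_one, mul_one,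
    one_mul]

theorem map_add_tmul {X Y D : Type u} [CStarAlgebra X] [CStarAlgebra Y] [CStarAlgebra D]
    (F : X ⊗[ℂ] Y →⋆ₐ[ℂ] D) (x x' : X) (y : Y) :
    F ((x + x') ⊗ₜ y) = F (x ⊗ₜ y) + F (x' ⊗ₜ y) := by
  rw [TensorProduct.add_tmul]
  exact map_add F _ _

theorem repHom_continuous {D : Type u} [CStarAlgebra D] {H : Type u} [NormedAddCommGroup H]
    [InnerProductSpace ℂ H] [CompleteSpace H] (f : D →⋆ₐ[ℂ] (H →L[ℂ] H)) : Continuous f :=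
  starAlgHom_continuous f

section Intertwine

variable {H K L : Type u} [NormedAddCommGroup H] [InnerProductSpace ℂ H] [CompleteSpace H]
  [NormedAddCommGroup K] [InnerProductSpace ℂ K] [CompleteSpace K]
  [NormedAddCommGroup L] [InnerProductSpace ℂ L] [CompleteSpace L]
  (f : MinTensor₃ A B C →⋆ₐ[ℂ]
    (HilbertTensor H (HilbertTensor K L) →L[ℂ] HilbertTensor H (HilbertTensor K L)))
  (π : A →⋆ₐ[ℂ] (H →L[ℂ] H)) (ρ : B →⋆ₐ[ℂ] (K →L[ℂ] K)) (σ : C →⋆ₐ[ℂ] (L →L[ℂ] L))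

theorem hom_algAssocRight (g : MinTensor B C →⋆ₐ[ℂ] (HilbertTensor K L →L[ℂ] HilbertTensor K L))
    (hf : ∀ a t, f ((minNorm₃ A B C).incl (a ⊗ₜ t)) = opTensor (π a) (g ((minNorm B C).incl t)))
    (a : A) (y : MinTensor B C) : f (algAssocRight (a ⊗ₜ y)) = opTensor (π a) (g y) := by
  refine (minNorm B C).denseRange_incl.induction_on
    (p := fun y => f (algAssocRight (a ⊗ₜ y)) = opTensor (π a) (g y)) y ?_ fun t => ?_
  · have h23 : Continuous (MinTensor.incl₂₃ : MinTensor B C →⋆ₐ[ℂ] MinTensor₃ A B C) :=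
      starAlgHom_continuous _
    have h1 : Continuous fun y : MinTensor B C => f (algAssocRight (a ⊗ₜ y)) := by
      simp only [algAssocRight_tmul]
      exact (repHom_continuous f).comp (continuous_const.mul h23)
    exact isClosed_eq h1 ((continuous_opTensor_right (π a)).comp (repHom_continuous g))
  · rw [algAssocRight_incl, hf]

set_option maxHeartbeats 1000000 in
theorem hom_algAssocLeft (g : MinTensor A B →⋆ₐ[ℂ] (HilbertTensor H K →L[ℂ] HilbertTensor H K))
    (hf : ∀ a b c, f ((minNorm₃ A B C).incl (a ⊗ₜ (b ⊗ₜ c))) =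
      opTensor (π a) (opTensor (ρ b) (σ c)))
    (hg : ∀ a b, g ((minNorm A B).incl (a ⊗ₜ b)) = opTensor (π a) (ρ b))
    (w : HilbertTensor (HilbertTensor H K) L) (y : MinTensor A B) (c : C) :
    hilbertAssoc H K L (opTensor (g y) (σ c) w) =
      f (algAssocLeft (y ⊗ₜ c)) (hilbertAssoc H K L w) := by
  refine (minNorm A B).denseRange_incl.induction_on
    (p := fun y => hilbertAssoc H K L (opTensor (g y) (σ c) w) =
      f (algAssocLeft (y ⊗ₜ c)) (hilbertAssoc H K L w)) y ?_ fun t => ?_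
  · have h12 : Continuous (MinTensor.incl₁₂ : MinTensor A B →⋆ₐ[ℂ] MinTensor₃ A B C) :=
      starAlgHom_continuous _
    have h1 : Continuous fun y : MinTensor A B => f (algAssocLeft (y ⊗ₜ c)) := by
      simp only [algAssocLeft_tmul]
      exact (repHom_continuous f).comp (h12.mul continuous_const)
    have h2 : Continuous fun y : MinTensor A B => opTensor (g y) (σ c) :=
      (continuous_opTensor_left (σ c)).comp (repHom_continuous g)
    exact isClosed_eq ((hilbertAssoc H K L).continuous.comp (h2.clm_apply continuous_const))
      (h1.clm_apply continuous_const)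
  · induction t with
    | zero =>
      have h : opTensor (0 : HilbertTensor H K →L[ℂ] HilbertTensor H K) (σ c) = 0 :=
        LinearMap.map_zero₂ opTensorBilin (σ c)
      rw [map_zero, map_zero, TensorProduct.zero_tmul, map_zero, map_zero, h]
      exact (hilbertAssoc H K L).map_zero
    | add s t hs ht =>
      have h (S T : HilbertTensor H K →L[ℂ] HilbertTensor H K) :
          opTensor (S + T) (σ c) = opTensor S (σ c) + opTensor T (σ c) :=
        LinearMap.map_add₂ opTensorBilin S T (σ c)
      have e1 : (minNorm A B).incl (s + t) = (minNorm A B).incl s + (minNorm A B).incl t :=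
        map_add (minNorm A B).incl s t
      have e2 (x y : MinTensor A B) : g (x + y) = g x + g y := map_add g x y
      have e3 (x y : MinTensor A B) : (algAssocLeft ((x + y) ⊗ₜ[ℂ] c) : MinTensor₃ A B C) =
          algAssocLeft (x ⊗ₜ[ℂ] c) + algAssocLeft (y ⊗ₜ[ℂ] c) :=
        map_add_tmul algAssocLeft x y c
      have e4 (x y : MinTensor₃ A B C) : f (x + y) = f x + f y := map_add f x y
      rw [e1, e2, e3, e4, h]
      exact ((hilbertAssoc H K L).map_add _ _).trans (congrArg₂ (· + ·) hs ht)
    | tmul a b => rw [algAssocLeft_incl, hf, hg, hilbertAssoc_opTensor]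

theorem intertwine_ext {S T : Type u} [Ring S] [StarRing S] [Algebra ℂ S] [StarModule ℂ S]
    [Ring T] [StarRing T] [Algebra ℂ T] [StarModule ℂ T]
    (F : S ⊗[ℂ] T →⋆ₐ[ℂ] (HilbertTensor (HilbertTensor H K) L →L[ℂ]
      HilbertTensor (HilbertTensor H K) L))
    (G : S ⊗[ℂ] T →⋆ₐ[ℂ] (HilbertTensor H (HilbertTensor K L) →L[ℂ]
      HilbertTensor H (HilbertTensor K L)))
    (w : HilbertTensor (HilbertTensor H K) L)
    (h : ∀ y c, hilbertAssoc H K L (F (y ⊗ₜ c) w) = G (y ⊗ₜ c) (hilbertAssoc H K L w))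
    (x : S ⊗[ℂ] T) : hilbertAssoc H K L (F x w) = G x (hilbertAssoc H K L w) := by
  induction x with
  | zero =>
    have e1 : F 0 = 0 := map_zero F
    have e2 : G 0 = 0 := map_zero G
    rw [e1, e2]
    exact (hilbertAssoc H K L).map_zero
  | add x y hx hy =>
    have e1 : F (x + y) = F x + F y := map_add F x y
    have e2 : G (x + y) = G x + G y := map_add G x y
    rw [e1, e2]
    exact ((hilbertAssoc H K L).map_add _ _).trans (congrArg₂ (· + ·) hx hy)
  | tmul y c => exact h y c

end Intertwine

theorem minTensor₃_algAssocRight (π : Rep A) (ρ : Rep B) (σ : Rep C) (x : A ⊗[ℂ] MinTensor B C) :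
    (π.minTensor₃ ρ σ).hom (algAssocRight x) = (π.tensor (ρ.minTensor σ)).hom x :=
  algHom_ext_tmul (f := (π.minTensor₃ ρ σ).hom.comp algAssocRight)
    (g := (π.tensor (ρ.minTensor σ)).hom)
    (hom_algAssocRight (π.minTensor₃ ρ σ).hom π.hom (ρ.minTensor σ).hom fun a t =>
      (Rep.minTensor₃_incl π ρ σ (a ⊗ₜ t)).trans
        (congrArg (opTensor (π.hom a)) (Rep.minTensor_incl ρ σ t).symm)) x

theorem minTensor₃_algAssocLeft (π : Rep A) (ρ : Rep B) (σ : Rep C) (x : MinTensor A B ⊗[ℂ] C)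
    (w : HilbertTensor (HilbertTensor π.space ρ.space) σ.space) :
    hilbertAssoc π.space ρ.space σ.space (((π.minTensor ρ).tensor σ).hom x w) =
      (π.minTensor₃ ρ σ).hom (algAssocLeft x) (hilbertAssoc π.space ρ.space σ.space w) := by
  exact intertwine_ext ((π.minTensor ρ).tensor σ).hom ((π.minTensor₃ ρ σ).hom.comp algAssocLeft) w
    (hom_algAssocLeft (π.minTensor₃ ρ σ).hom π.hom ρ.hom σ.hom (π.minTensor ρ).hom
      (fun a b c => Rep.minTensor₃_incl π ρ σ (a ⊗ₜ (b ⊗ₜ c)))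
      (fun a b => Rep.minTensor_incl π ρ (a ⊗ₜ b)) w) x

theorem norm_algAssocRight_le (x : A ⊗[ℂ] MinTensor B C) :
    ‖algAssocRight x‖ ≤ (minNorm A (MinTensor B C)).toSeminorm x := by
  refine norm_le_minTensor₃ _ _ (apply_nonneg _ _) fun π ρ σ => ?_
  rw [minTensor₃_algAssocRight]
  exact le_minNorm _ _ x

theorem norm_algAssocLeft_le (x : MinTensor A B ⊗[ℂ] C) :
    ‖algAssocLeft x‖ ≤ (minNorm (MinTensor A B) C).toSeminorm x := by
  refine norm_le_minTensor₃ _ _ (apply_nonneg _ _) fun π ρ σ => ?_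
  exact (norm_le_of_intertwine _ _ (minTensor₃_algAssocLeft π ρ σ x)).trans (le_minNorm _ _ x)

/-- The canonical identification of `A ⊗ (B ⊗ C)` with `A ⊗ B ⊗ C`. -/
noncomputable def MinTensor.assocRight : MinTensor A (MinTensor B C) →⋆ₐ[ℂ] MinTensor₃ A B C :=
  (minNorm A (MinTensor B C)).lift algAssocRight norm_algAssocRight_le

/-- The canonical identification of `(A ⊗ B) ⊗ C` with `A ⊗ B ⊗ C`. -/
noncomputable def MinTensor.assocLeft : MinTensor (MinTensor A B) C →⋆ₐ[ℂ] MinTensor₃ A B C :=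
  (minNorm (MinTensor A B) C).lift algAssocLeft norm_algAssocLeft_le

theorem MinTensor.assocRight_tmul (a : A) (b : B) (c : C) :
    MinTensor.assocRight (MinTensor.tmul a (MinTensor.tmul b c)) =
      (minNorm₃ A B C).incl (a ⊗ₜ (b ⊗ₜ c)) :=
  ((minNorm A (MinTensor B C)).lift_incl _ norm_algAssocRight_le _).trans
    (algAssocRight_incl a (b ⊗ₜ c))

theorem MinTensor.assocLeft_tmul (a : A) (b : B) (c : C) :
    MinTensor.assocLeft (MinTensor.tmul (MinTensor.tmul a b) c) =
      (minNorm₃ A B C).incl (a ⊗ₜ (b ⊗ₜ c)) :=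
  ((minNorm (MinTensor A B) C).lift_incl _ norm_algAssocLeft_le _).trans
    (algAssocLeft_incl a b c)

end Assoc

section QuantumMaps

/-! In the following, a C*-algebra `A` is regarded as the algebra of continuous functions on a
compact quantum space. All algebras are unital, and so are all *-homomorphisms. -/

/-- A quantum family of maps `Φ : C(Y) → C(X) ⊗ C(E)`, parametrized by the quantum space `E`, is the
quantum family of all maps `X → Y` if every quantum family of maps `Ψ : C(Y) → C(X) ⊗ C(D)` is
`(id ⊗ Λ) ∘ Φ` for a unique *-homomorphism `Λ : C(E) → C(D)`. -/
def IsFamilyOfAllMaps {X Y E : Type u} [CStarAlgebra X] [CStarAlgebra Y] [CStarAlgebra E]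
    (Φ : Y →⋆ₐ[ℂ] MinTensor X E) : Prop :=
  ∀ (D : Type u) [CStarAlgebra D] (Ψ : Y →⋆ₐ[ℂ] MinTensor X D),
    ∃! Λ : E →⋆ₐ[ℂ] D, (MinTensor.map (StarAlgHom.id ℂ X) Λ).comp Φ = Ψ

/-- The composition `Ψ₁ △ Ψ₂ = (Ψ₁ ⊗ id) ∘ Ψ₂` of quantum families of maps, with values in
`C(X₁) ⊗ C(D₁) ⊗ C(D₂)`. -/
noncomputable def familyComp {X₁ X₂ X₃ D₁ D₂ : Type u} [CStarAlgebra X₁] [CStarAlgebra X₂]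
    [CStarAlgebra X₃] [CStarAlgebra D₁] [CStarAlgebra D₂]
    (Ψ₁ : X₂ →⋆ₐ[ℂ] MinTensor X₁ D₁) (Ψ₂ : X₃ →⋆ₐ[ℂ] MinTensor X₂ D₂) :
    X₃ →⋆ₐ[ℂ] MinTensor₃ X₁ D₁ D₂ :=
  MinTensor.assocLeft.comp ((MinTensor.map Ψ₁ (StarAlgHom.id ℂ D₂)).comp Ψ₂)

/-- The relation `Φ △ Φ = (id ⊗ Δ) ∘ Φ` in `C(M) ⊗ C(E) ⊗ C(E)`. -/
def IsInducedComul {M E : Type u} [CStarAlgebra M] [CStarAlgebra E]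
    (Φ : M →⋆ₐ[ℂ] MinTensor M E) (Δ : E →⋆ₐ[ℂ] MinTensor E E) : Prop :=
  familyComp Φ Φ = MinTensor.assocRight.comp ((MinTensor.map (StarAlgHom.id ℂ M) Δ).comp Φ)

/-- The relation `(id ⊗ ε) ∘ Φ = id`. -/
def ActsAsIdentity {M E : Type u} [CStarAlgebra M] [CStarAlgebra E]
    (Φ : M →⋆ₐ[ℂ] MinTensor M E) (ε : E →⋆ₐ[ℂ] ℂ) : Prop :=
  (MinTensor.sliceRight ε).comp Φ = StarAlgHom.id ℂ M

/-- Coassociativity `(Δ ⊗ id) ∘ Δ = (id ⊗ Δ) ∘ Δ`, as maps into the triple tensor product. -/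
def IsCoassociative {G : Type u} [CStarAlgebra G] (Δ : G →⋆ₐ[ℂ] MinTensor G G) : Prop :=
  MinTensor.assocLeft.comp ((MinTensor.map Δ (StarAlgHom.id ℂ G)).comp Δ) =
    MinTensor.assocRight.comp ((MinTensor.map (StarAlgHom.id ℂ G) Δ).comp Δ)

/-- The character `ε` is a counit: `(ε ⊗ id) ∘ Δ = id = (id ⊗ ε) ∘ Δ`. -/
def IsCounit {G : Type u} [CStarAlgebra G] (Δ : G →⋆ₐ[ℂ] MinTensor G G)
    (ε : G →⋆ₐ[ℂ] ℂ) : Prop :=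
  (MinTensor.sliceLeft ε).comp Δ = StarAlgHom.id ℂ G ∧
    (MinTensor.sliceRight ε).comp Δ = StarAlgHom.id ℂ G

/-- The pair `(C(G), Δ)` is a compact quantum semigroup with unit. -/
def IsCompactQuantumSemigroupWithUnit {G : Type u} [CStarAlgebra G]
    (Δ : G →⋆ₐ[ℂ] MinTensor G G) : Prop :=
  IsCoassociative Δ ∧ ∃ ε : G →⋆ₐ[ℂ] ℂ, IsCounit Δ ε

end QuantumMaps

end QuantumSpace

/-!
The quantum family of all maps represents the functor of quantum families, so a *-homomorphism out of
`C(E)` is the same as the family of maps that it induces, and an equation between such homomorphisms may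
be checked on `Φ` (`IsFamilyOfAllMaps.hom_ext`). The comultiplication is the homomorphism which induces
`Φ △ Φ`, and the counit the one which induces the trivial family `m ↦ m ⊗ 1`. Composition of families is
associative and has the trivial family as unit, which gives coassociativity and the counit identities.

For this the family `Φ △ Φ`, which takes values in the triple tensor product `C(M) ⊗ C(E) ⊗ C(E)`, has to
be regarded as a family with values in `C(M) ⊗ (C(E) ⊗ C(E))`. The analytic part of the argument is
therefore that the canonical map `MinTensor.assocRight` from `A ⊗ (B ⊗ C)` to `A ⊗ B ⊗ C` is bijective.
It is injective because an element `x` of a minimal tensor product `A ⊗ D` is determined by its slices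
`(ω ⊗ id) x` along the matrix coefficients `ω` of representations of `A`
(`MinTensor.eq_zero_of_forall_vectorSlice`), and for `D = B ⊗ C` these slices are determined by the
representations `ρ ⊗ σ` of `D`. An injective *-homomorphism is isometric, and the image of `assocRight` is
dense, so it is surjective as well. The resulting map `MinTensor.assoc` from `(A ⊗ B) ⊗ C` to
`A ⊗ (B ⊗ C)` is natural and satisfies the pentagon identity (`MinTensor.assoc_pentagon`), as one checks on
elementary tensors.
-/

namespace QuantumSpace

open UniformSpace

/-! ### Slice maps of vector functionals -/

section VectorSlice

variable {A B C : Type u} [CStarAlgebra A] [CStarAlgebra B] [CStarAlgebra C]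

theorem norm_le_of_forall_inner {H : Type u} [NormedAddCommGroup H] [InnerProductSpace ℂ H]
    (T : H →L[ℂ] H) {c : ℝ} (hc : 0 ≤ c) (h : ∀ k k', ‖inner ℂ k (T k')‖ ≤ c * ‖k‖ * ‖k'‖) :
    ‖T‖ ≤ c := by
  refine T.opNorm_le_bound hc fun v => ?_
  rcases (norm_nonneg (T v)).eq_or_lt with h0 | h0
  · rw [← h0]; positivity
  · have h1 := h (T v) v
    rw [inner_self_eq_norm_sq_to_K, norm_pow, RCLike.norm_ofReal, abs_norm, pow_two] at h1
    exact le_of_mul_le_mul_right (h1.trans_eq (by ring)) h0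

/-- The slice map `a ⊗ b ↦ ⟪h, π(a) h'⟫ • b` on the algebraic tensor product, attached to the
matrix coefficient of the representation `π` at `h` and `h'`. -/
noncomputable def algVectorSlice (π : Rep A) (h h' : π.space) : A ⊗[ℂ] B →ₗ[ℂ] B :=
  TensorProduct.lift
    (LinearMap.mk₂ ℂ (fun (a : A) (b : B) => (inner ℂ h (π.hom a h') : ℂ) • b)
      (fun a a' b => by
        rw [map_add, add_apply, inner_add_right, add_smul])
      (fun c a b => by
        rw [map_smul, smul_apply, inner_smul_right, mul_smul])
      (fun a b b' => smul_add _ _ _)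
      (fun c a b => smul_comm _ _ _))

theorem algVectorSlice_tmul (π : Rep A) (h h' : π.space) (a : A) (b : B) :
    algVectorSlice π h h' (a ⊗ₜ[ℂ] b) = (inner ℂ h (π.hom a h') : ℂ) • b := rfl

/-- The elementary tensor `h ⊗ k` in the Hilbert space tensor product. -/
noncomputable def hilbertTmul {H K : Type u} [NormedAddCommGroup H] [InnerProductSpace ℂ H]
    [NormedAddCommGroup K] [InnerProductSpace ℂ K] (h : H) (k : K) : HilbertTensor H K :=
  ((h ⊗ₜ[ℂ] k : H ⊗[ℂ] K) : HilbertTensor H K)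

theorem norm_hilbertTmul {H K : Type u} [NormedAddCommGroup H] [InnerProductSpace ℂ H]
    [NormedAddCommGroup K] [InnerProductSpace ℂ K] (h : H) (k : K) :
    ‖hilbertTmul h k‖ = ‖h‖ * ‖k‖ := by
  rw [hilbertTmul, Completion.norm_coe, TensorProduct.norm_tmul]

theorem inner_hilbertTmul_opTensor {H K : Type u} [NormedAddCommGroup H] [InnerProductSpace ℂ H]
    [NormedAddCommGroup K] [InnerProductSpace ℂ K] (S : H →L[ℂ] H) (T : K →L[ℂ] K)
    (h h' : H) (k k' : K) :
    (inner ℂ (hilbertTmul h k) (opTensor S T (hilbertTmul h' k')) : ℂ) =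
      inner ℂ h (S h') * inner ℂ k (T k') := by
  rw [hilbertTmul, hilbertTmul, opTensor_coe, Completion.inner_coe, TensorProduct.mapL_tmul,
    TensorProduct.inner_tmul]

/-- An operator on a Hilbert space tensor product vanishes if its matrix coefficients at elementary
tensors do. -/
theorem eq_zero_of_inner_hilbertTmul {H K : Type u} [NormedAddCommGroup H] [InnerProductSpace ℂ H]
    [NormedAddCommGroup K] [InnerProductSpace ℂ K] (T : HilbertTensor H K →L[ℂ] HilbertTensor H K)
    (hT : ∀ (h h' : H) (k k' : K),
      (inner ℂ (hilbertTmul h k) (T (hilbertTmul h' k')) : ℂ) = 0) : T = 0 := by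
  refine op_ext fun y => ?_
  refine (?_ : T (y : HilbertTensor H K) = 0)
  refine ext_inner_left ℂ fun x => ?_
  rw [inner_zero_right]
  induction x using Completion.induction_on with
  | hp => exact isClosed_eq (by fun_prop) continuous_const
  | ih x =>
    induction x with
    | zero => rw [Completion.coe_zero, inner_zero_left]
    | add x x' hx hx' => rw [Completion.coe_add, inner_add_left, hx, hx', add_zero]
    | tmul h k =>
      induction y with
      | zero => rw [Completion.coe_zero, map_zero, inner_zero_right]
      | add y y' hy hy' => rw [Completion.coe_add, map_add, inner_add_right, hy, hy', add_zero]
      | tmul h' k' => exact hT h h' k k'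

/-- The matrix coefficients of `π ⊗ ρ` at elementary tensors are those of `ρ` on the vector slices. -/
theorem inner_tensor_hilbertTmul (π : Rep A) (ρ : Rep B) (h h' : π.space) (k k' : ρ.space)
    (t : A ⊗[ℂ] B) :
    (inner ℂ (hilbertTmul h k) ((π.tensor ρ).hom t (hilbertTmul h' k')) : ℂ) =
      inner ℂ k (ρ.hom (algVectorSlice π h h' t) k') := by
  induction t with
  | zero =>
    rw [map_zero, map_zero, map_zero, zero_apply, inner_zero_right]
    exact inner_zero_right _
  | add x y hx hy =>
    rw [map_add, map_add, map_add, add_apply, inner_add_right, ← hx, ← hy]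
    exact inner_add_right _ _ _
  | tmul a b =>
    rw [algVectorSlice_tmul, map_smul, smul_apply, inner_smul_right]
    exact inner_hilbertTmul_opTensor _ _ _ _ _ _

theorem norm_algVectorSlice_le (π : Rep A) (h h' : π.space) (t : A ⊗[ℂ] B) :
    ‖algVectorSlice π h h' t‖ ≤ ‖h‖ * ‖h'‖ * ‖(minNorm A B).incl t‖ := by
  obtain ⟨ρ, hρ⟩ := exists_rep (algVectorSlice π h h' t)
  refine hρ.trans (norm_le_of_forall_inner _ (by positivity) fun k k' => ?_)
  rw [← inner_tensor_hilbertTmul]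
  refine (norm_inner_le_norm _ _).trans ?_
  have h1 : ‖(π.tensor ρ).hom t (hilbertTmul h' k')‖ ≤
      ‖(minNorm A B).incl t‖ * ‖hilbertTmul h' k'‖ := by
    rw [CStarSeminorm.norm_incl]
    exact ContinuousLinearMap.le_of_opNorm_le _ (le_minNorm π ρ t) _
  refine (mul_le_mul_of_nonneg_left h1 (norm_nonneg _)).trans_eq ?_
  rw [norm_hilbertTmul, norm_hilbertTmul]
  ring

/-- The slice map `a ⊗ b ↦ ⟪h, π(a) h'⟫ • b` on the minimal tensor product: the continuous extension
of `algVectorSlice`. -/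
noncomputable def MinTensor.vectorSlice (π : Rep A) (h h' : π.space) : MinTensor A B →L[ℂ] B :=
  (algVectorSlice π h h').extendOfNorm (minNorm A B).incl.toAlgHom.toLinearMap

theorem MinTensor.vectorSlice_incl (π : Rep A) (h h' : π.space) (t : A ⊗[ℂ] B) :
    MinTensor.vectorSlice π h h' ((minNorm A B).incl t) = algVectorSlice π h h' t :=
  LinearMap.extendOfNorm_eq (e := (minNorm A B).incl.toAlgHom.toLinearMap)
    (minNorm A B).denseRange_incl ⟨_, norm_algVectorSlice_le π h h'⟩ t

theorem inner_minTensor_hilbertTmul (π : Rep A) (ρ : Rep B) (h h' : π.space) (k k' : ρ.space)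
    (x : MinTensor A B) :
    (inner ℂ (hilbertTmul h k) ((π.minTensor ρ).hom x (hilbertTmul h' k')) : ℂ) =
      inner ℂ k (ρ.hom (MinTensor.vectorSlice π h h' x) k') := by
  refine (minNorm A B).denseRange_incl.induction_on
    (p := fun x => (inner ℂ (hilbertTmul h k) ((π.minTensor ρ).hom x (hilbertTmul h' k')) : ℂ) =
      inner ℂ k (ρ.hom (MinTensor.vectorSlice π h h' x) k')) x ?_ fun t => ?_
  · have h1 : Continuous (π.minTensor ρ).hom := repHom_continuous _
    have h2 : Continuous ρ.hom := repHom_continuous _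
    exact isClosed_eq (continuous_const.inner (h1.clm_apply continuous_const))
      (continuous_const.inner ((h2.comp (MinTensor.vectorSlice π h h').continuous).clm_apply
        continuous_const))
  · rw [Rep.minTensor_incl, MinTensor.vectorSlice_incl]
    exact inner_tensor_hilbertTmul π ρ h h' k k' t

theorem MinTensor.eq_zero_of_forall_rep (x : MinTensor A B)
    (h : ∀ (π : Rep A) (ρ : Rep B), (π.minTensor ρ).hom x = 0) : x = 0 :=
  norm_le_zero_iff.mp <| (minNorm A B).norm_le_of_forall (ι := Rep A × Rep B) _
    (fun R => (R.1.minTensor R.2).hom)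
    (fun t r hr ht => minNorm_le hr fun π ρ => by
      rw [← Rep.minTensor_incl]; exact ht (π, ρ)) x 0 le_rfl
    fun R => ((congrArg norm (h R.1 R.2)).trans norm_zero).le

/-- The slice maps of vector functionals separate the points of the minimal tensor product. -/
theorem MinTensor.eq_zero_of_forall_vectorSlice (x : MinTensor A B)
    (hx : ∀ (π : Rep A) (h h' : π.space), MinTensor.vectorSlice π h h' x = 0) : x = 0 := by
  refine MinTensor.eq_zero_of_forall_rep x fun π ρ => ?_
  refine eq_zero_of_inner_hilbertTmul _ fun h h' k k' => ?_
  refine (inner_minTensor_hilbertTmul π ρ h h' k k' x).trans ?_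
  rw [hx, map_zero, zero_apply, inner_zero_right]

end VectorSlice

/-! ### Homomorphisms on minimal tensor products -/

namespace MinTensor

variable {A B C D : Type u} [CStarAlgebra A] [CStarAlgebra B] [CStarAlgebra C] [CStarAlgebra D]

/-- The *-homomorphism `a ↦ a ⊗ 1`. -/
noncomputable def inl : A →⋆ₐ[ℂ] MinTensor A B := (minNorm A B).incl.comp algInl

/-- The *-homomorphism `b ↦ 1 ⊗ b`. -/
noncomputable def inr : B →⋆ₐ[ℂ] MinTensor A B := (minNorm A B).incl.comp algInr

theorem inl_apply (a : A) : (inl a : MinTensor A B) = tmul a 1 := rfl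

theorem inr_apply (b : B) : (inr b : MinTensor A B) = tmul 1 b := rfl

theorem tmul_mul_tmul (a a' : A) (b b' : B) :
    tmul a b * tmul a' b' = tmul (a * a') (b * b') :=
  (map_mul (minNorm A B).incl (a ⊗ₜ b) (a' ⊗ₜ b')).symm.trans
    (congrArg _ (Algebra.TensorProduct.tmul_mul_tmul a a' b b'))

theorem inl_mul_inr (a : A) (b : B) : (inl a * inr b : MinTensor A B) = tmul a b := by
  rw [inl_apply, inr_apply, tmul_mul_tmul, mul_one, one_mul]

theorem tmul_one_one : (tmul 1 1 : MinTensor A B) = 1 := map_one (inl : A →⋆ₐ[ℂ] MinTensor A B)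

theorem tmul_smul (c : ℂ) (a : A) (b : B) : tmul a (c • b) = tmul (c • a) b :=
  congrArg (minNorm A B).incl (TensorProduct.smul_tmul c a b).symm

theorem smul_tmul (c : ℂ) (a : A) (b : B) : tmul (c • a) b = c • tmul a b :=
  map_smul (minNorm A B).incl c (a ⊗ₜ b)

theorem hom_ext {f g : MinTensor A B →⋆ₐ[ℂ] D} (h : ∀ a b, f (tmul a b) = g (tmul a b)) :
    f = g := by
  refine StarAlgHom.ext fun x => ?_
  refine (minNorm A B).denseRange_incl.induction_on (p := fun x => f x = g x) x ?_ fun t => ?_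
  · exact isClosed_eq (starAlgHom_continuous f) (starAlgHom_continuous g)
  · exact algHom_ext_tmul (f := f.comp (minNorm A B).incl) (g := g.comp (minNorm A B).incl) h t

theorem hom_ext_inl_inr {f g : MinTensor A B →⋆ₐ[ℂ] D} (hl : f.comp inl = g.comp inl)
    (hr : ∀ b, f (tmul 1 b) = g (tmul 1 b)) : f = g :=
  hom_ext fun a b => by
    rw [← inl_mul_inr, map_mul, map_mul]
    exact congrArg₂ (· * ·) (DFunLike.congr_fun hl a) (hr b)

theorem hom_ext_left {f g : MinTensor (MinTensor A B) C →⋆ₐ[ℂ] D}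
    (h : ∀ a b c, f (tmul (tmul a b) c) = g (tmul (tmul a b) c)) : f = g :=
  hom_ext_inl_inr (hom_ext fun a b => h a b 1) fun c => by
    rw [← tmul_one_one]; exact h 1 1 c

theorem hom_ext_left_left {X : Type u} [CStarAlgebra X]
    {f g : MinTensor (MinTensor (MinTensor A B) C) D →⋆ₐ[ℂ] X}
    (h : ∀ a b c d, f (tmul (tmul (tmul a b) c) d) = g (tmul (tmul (tmul a b) c) d)) : f = g :=
  hom_ext_inl_inr (hom_ext_left fun a b c => h a b c 1) fun d => by
    rw [← tmul_one_one, ← tmul_one_one]; exact h 1 1 1 d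

section Map

variable {A' A'' B' B'' : Type u} [CStarAlgebra A'] [CStarAlgebra A''] [CStarAlgebra B']
  [CStarAlgebra B'']

theorem map_comp_map (f : A →⋆ₐ[ℂ] A') (f' : A' →⋆ₐ[ℂ] A'') (g : B →⋆ₐ[ℂ] B')
    (g' : B' →⋆ₐ[ℂ] B'') : (map f' g').comp (map f g) = map (f'.comp f) (g'.comp g) :=
  hom_ext fun a b => by
    rw [StarAlgHom.comp_apply, map_tmul, map_tmul, map_tmul]; rfl

theorem map_map (f : A →⋆ₐ[ℂ] A') (f' : A' →⋆ₐ[ℂ] A'') (g : B →⋆ₐ[ℂ] B')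
    (g' : B' →⋆ₐ[ℂ] B'') (x : MinTensor A B) :
    map f' g' (map f g x) = map (f'.comp f) (g'.comp g) x :=
  DFunLike.congr_fun (map_comp_map f f' g g') x

theorem map_id_comp (g : B →⋆ₐ[ℂ] B') (g' : B' →⋆ₐ[ℂ] B'') (x : MinTensor A B) :
    map (StarAlgHom.id ℂ A) (g'.comp g) x =
      map (StarAlgHom.id ℂ A) g' (map (StarAlgHom.id ℂ A) g x) := by
  rw [map_map, StarAlgHom.id_comp]

theorem map_comp_id (f : A →⋆ₐ[ℂ] A') (f' : A' →⋆ₐ[ℂ] A'') (x : MinTensor A B) :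
    map (f'.comp f) (StarAlgHom.id ℂ B) x =
      map f' (StarAlgHom.id ℂ B) (map f (StarAlgHom.id ℂ B) x) := by
  rw [map_map, StarAlgHom.id_comp]

theorem map_map_id (f : A →⋆ₐ[ℂ] A') (g : B →⋆ₐ[ℂ] B') (x : MinTensor A B) :
    map f (StarAlgHom.id ℂ B') (map (StarAlgHom.id ℂ A) g x) = map f g x := by
  rw [map_map, StarAlgHom.id_comp, StarAlgHom.comp_id]

theorem map_id_map (f : A →⋆ₐ[ℂ] A') (g : B →⋆ₐ[ℂ] B') (x : MinTensor A B) :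
    map (StarAlgHom.id ℂ A') g (map f (StarAlgHom.id ℂ B) x) = map f g x := by
  rw [map_map, StarAlgHom.id_comp, StarAlgHom.comp_id]

theorem map_id_id : map (StarAlgHom.id ℂ A) (StarAlgHom.id ℂ B) = StarAlgHom.id ℂ _ :=
  hom_ext fun a b => map_tmul _ _ a b

/-- If `Λ` is the character `ε` followed by the embedding of the scalars in `D`, then `id ⊗ Λ` is the
slice map of `ε` followed by `a ↦ a ⊗ 1`. -/
theorem map_id_scalar (ε : B →⋆ₐ[ℂ] ℂ) (Λ : B →⋆ₐ[ℂ] D) (h : ∀ b, Λ b = algebraMap ℂ D (ε b)) :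
    map (StarAlgHom.id ℂ A) Λ = (inl : A →⋆ₐ[ℂ] MinTensor A D).comp (sliceRight ε) :=
  hom_ext fun a b => by
    rw [map_tmul, StarAlgHom.comp_apply, sliceRight_tmul, inl_apply, h,
      Algebra.algebraMap_eq_smul_one, tmul_smul]
    rfl

end Map

/-! ### Associativity -/

theorem minTensor₃_assocRight (π : Rep A) (ρ : Rep B) (σ : Rep C) (x : MinTensor A (MinTensor B C)) :
    (π.minTensor₃ ρ σ).hom (assocRight x) = (π.minTensor (ρ.minTensor σ)).hom x := by
  refine (minNorm A (MinTensor B C)).denseRange_incl.induction_on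
    (p := fun x => (π.minTensor₃ ρ σ).hom (assocRight x) = (π.minTensor (ρ.minTensor σ)).hom x)
    x ?_ fun t => ?_
  · exact isClosed_eq ((repHom_continuous _).comp (starAlgHom_continuous assocRight))
      (repHom_continuous _)
  · rw [Rep.minTensor_incl, ← minTensor₃_algAssocRight]
    exact congrArg (π.minTensor₃ ρ σ).hom
      ((minNorm A (MinTensor B C)).lift_incl _ norm_algAssocRight_le t)

/-- The minimal norm on `A ⊗ (B ⊗ C)` is a supremum over all representations of `B ⊗ C`, but the norm
on `A ⊗ B ⊗ C` sees only those of the form `ρ ⊗ σ`. These suffice for injectivity, since they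
already separate the points of `B ⊗ C`, where the vector slices of the first factor take values. -/
theorem assocRight_injective :
    Function.Injective (assocRight : MinTensor A (MinTensor B C) →⋆ₐ[ℂ] MinTensor₃ A B C) := by
  refine (injective_iff_map_eq_zero _).mpr fun x hx => ?_
  refine eq_zero_of_forall_vectorSlice x fun π h h' => ?_
  refine eq_zero_of_forall_rep _ fun ρ σ => ?_
  refine norm_le_zero_iff.mp (norm_le_of_forall_inner _ le_rfl fun k k' => ?_)
  have h0 : (π.minTensor (ρ.minTensor σ)).hom x = 0 := by
    rw [← minTensor₃_assocRight, hx]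
    exact map_zero _
  have h1 := inner_minTensor_hilbertTmul π (ρ.minTensor σ) h h' k k' x
  rw [← h1, h0]
  refine (norm_eq_zero.mpr ?_).trans_le (by positivity)
  exact inner_zero_right _

theorem incl_mem_range_assocRight (t : A ⊗[ℂ] (B ⊗[ℂ] C)) :
    (minNorm₃ A B C).incl t ∈ (assocRight : MinTensor A (MinTensor B C) →⋆ₐ[ℂ] _).range := by
  induction t with
  | zero => rw [map_zero]; exact zero_mem _
  | add x y hx hy => rw [map_add]; exact add_mem hx hy
  | tmul a t =>
    exact ⟨(minNorm A (MinTensor B C)).incl (a ⊗ₜ (minNorm B C).incl t),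
      ((minNorm A (MinTensor B C)).lift_incl _ norm_algAssocRight_le _).trans
        (algAssocRight_incl a t)⟩

/-- The range of `assocRight` is dense, and it is closed because an injective *-homomorphism of
C*-algebras is isometric. -/
theorem assocRight_surjective :
    Function.Surjective (assocRight : MinTensor A (MinTensor B C) →⋆ₐ[ℂ] MinTensor₃ A B C) := by
  have hi : Isometry (assocRight : MinTensor A (MinTensor B C) →⋆ₐ[ℂ] MinTensor₃ A B C) :=
    NonUnitalStarAlgHom.isometry _ assocRight_injective
  intro y
  refine (minNorm₃ A B C).denseRange_incl.induction_on (p := fun y => ∃ x, assocRight x = y) y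
    ?_ fun t => incl_mem_range_assocRight t
  exact hi.isClosedEmbedding.isClosed_range

variable (A B C) in
/-- The isomorphism of `A ⊗ (B ⊗ C)` with `A ⊗ B ⊗ C`. -/
noncomputable def assocRightEquiv : MinTensor A (MinTensor B C) ≃⋆ₐ[ℂ] MinTensor₃ A B C :=
  StarAlgEquiv.ofBijective assocRight ⟨assocRight_injective, assocRight_surjective⟩

/-- The associativity map from `(A ⊗ B) ⊗ C` to `A ⊗ (B ⊗ C)`, obtained from the identifications of
both algebras with the triple tensor product. -/
noncomputable def assoc : MinTensor (MinTensor A B) C →⋆ₐ[ℂ] MinTensor A (MinTensor B C) :=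
  ((assocRightEquiv A B C).symm : MinTensor₃ A B C →⋆ₐ[ℂ] _).comp assocLeft

theorem assocRight_comp_assoc :
    assocRight.comp (assoc : MinTensor (MinTensor A B) C →⋆ₐ[ℂ] MinTensor A (MinTensor B C)) =
      assocLeft :=
  StarAlgHom.ext fun x => (assocRightEquiv A B C).apply_symm_apply (assocLeft x)

theorem assoc_tmul (a : A) (b : B) (c : C) :
    assoc (tmul (tmul a b) c) = tmul a (tmul b c) :=
  assocRight_injective <| (DFunLike.congr_fun assocRight_comp_assoc _).trans
    ((assocLeft_tmul a b c).trans (assocRight_tmul a b c).symm)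

theorem assoc_comp_map {A' B' C' : Type u} [CStarAlgebra A'] [CStarAlgebra B'] [CStarAlgebra C']
    (f : A →⋆ₐ[ℂ] A') (g : B →⋆ₐ[ℂ] B') (h : C →⋆ₐ[ℂ] C') :
    assoc.comp (map (map f g) h) = (map f (map g h)).comp assoc :=
  hom_ext_left fun a b c => by
    simp only [StarAlgHom.comp_apply, map_tmul, assoc_tmul]

theorem map_assoc {A' B' C' : Type u} [CStarAlgebra A'] [CStarAlgebra B'] [CStarAlgebra C']
    (f : A →⋆ₐ[ℂ] A') (g : B →⋆ₐ[ℂ] B') (h : C →⋆ₐ[ℂ] C') (x : MinTensor (MinTensor A B) C) :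
    map f (map g h) (assoc x) = assoc (map (map f g) h x) :=
  (DFunLike.congr_fun (assoc_comp_map f g h) x).symm

theorem assoc_pentagon :
    (map (StarAlgHom.id ℂ A)
        (assoc : MinTensor (MinTensor B C) D →⋆ₐ[ℂ] MinTensor B (MinTensor C D))).comp
      (assoc.comp (map (assoc : MinTensor (MinTensor A B) C →⋆ₐ[ℂ] MinTensor A (MinTensor B C))
        (StarAlgHom.id ℂ D))) =
      (assoc : MinTensor (MinTensor A B) (MinTensor C D) →⋆ₐ[ℂ]
          MinTensor A (MinTensor B (MinTensor C D))).comp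
        (assoc : MinTensor (MinTensor (MinTensor A B) C) D →⋆ₐ[ℂ]
          MinTensor (MinTensor A B) (MinTensor C D)) :=
  hom_ext_left_left fun a b c d => by
    simp only [StarAlgHom.comp_apply, map_tmul, assoc_tmul, StarAlgHom.coe_id, id]

theorem map_sliceLeft_comp_assoc (ε : B →⋆ₐ[ℂ] ℂ) :
    (map (StarAlgHom.id ℂ A) (sliceLeft ε)).comp
        (assoc : MinTensor (MinTensor A B) C →⋆ₐ[ℂ] MinTensor A (MinTensor B C)) =
      map (sliceRight ε) (StarAlgHom.id ℂ C) :=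
  hom_ext_left fun a b c => by
    simp only [StarAlgHom.comp_apply, map_tmul, assoc_tmul, sliceLeft_tmul, sliceRight_tmul,
      tmul_smul]
    rfl

theorem map_sliceRight_comp_assoc (ε : C →⋆ₐ[ℂ] ℂ) :
    (map (StarAlgHom.id ℂ A) (sliceRight ε)).comp
        (assoc : MinTensor (MinTensor A B) C →⋆ₐ[ℂ] MinTensor A (MinTensor B C)) =
      sliceRight ε :=
  hom_ext_left fun a b c => by
    simp only [StarAlgHom.comp_apply, map_tmul, assoc_tmul, sliceRight_tmul, tmul_smul, smul_tmul]
    rfl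

theorem sliceRight_comp_map (ε : B →⋆ₐ[ℂ] ℂ) (f : A →⋆ₐ[ℂ] D) :
    (sliceRight ε).comp (map f (StarAlgHom.id ℂ B)) = f.comp (sliceRight ε) :=
  hom_ext fun a b => by
    simp only [StarAlgHom.comp_apply, map_tmul, sliceRight_tmul, map_smul]
    rfl

end MinTensor

/-! ### Lifting C*-algebras to a higher universe -/

section ULift

/-! The universal property of a quantum family only concerns algebras `D` in a fixed universe `u`. The
scalars enter it as `ULift ℂ`. -/

variable {A : Type*} [CStarAlgebra A]

instance : StarRing (ULift.{u} A) := Equiv.ulift.starRing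

noncomputable instance : CStarAlgebra (ULift.{u} A) where
  norm_mul_self_le x := CStarRing.norm_mul_self_le x.down
  star_smul c x := ULift.down_injective (star_smul c x.down)

/-- The *-isomorphism of `ULift A` with `A`. -/
def uliftStarAlgEquiv : ULift.{u} A ≃⋆ₐ[ℂ] A where
  __ := ULift.ringEquiv
  map_star' _ := rfl
  map_smul' _ _ := rfl

end ULift

/-! ### The quantum semigroup structure -/

section Semigroup

variable {M E : Type u} [CStarAlgebra M] [CStarAlgebra E] {Φ : M →⋆ₐ[ℂ] MinTensor M E}

/-- *-homomorphisms out of the parameter algebra of the quantum family of all maps are determined by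
the families which they induce. -/
theorem IsFamilyOfAllMaps.hom_ext {X Y E D : Type u} [CStarAlgebra X] [CStarAlgebra Y]
    [CStarAlgebra E] [CStarAlgebra D] {Φ : Y →⋆ₐ[ℂ] MinTensor X E} (hΦ : IsFamilyOfAllMaps Φ)
    {f g : E →⋆ₐ[ℂ] D}
    (h : ∀ y, MinTensor.map (StarAlgHom.id ℂ X) f (Φ y) =
      MinTensor.map (StarAlgHom.id ℂ X) g (Φ y)) : f = g :=
  (hΦ D ((MinTensor.map (StarAlgHom.id ℂ X) g).comp Φ)).unique (StarAlgHom.ext h) rfl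

/-- After identifying `(A ⊗ B) ⊗ C` with `A ⊗ (B ⊗ C)`, the relation defining the comultiplication
reads `(id ⊗ Δ) ∘ Φ = (Φ ⊗ id) ∘ Φ`. -/
theorem isInducedComul_iff {Δ : E →⋆ₐ[ℂ] MinTensor E E} :
    IsInducedComul Φ Δ ↔ (MinTensor.map (StarAlgHom.id ℂ M) Δ).comp Φ =
      MinTensor.assoc.comp ((MinTensor.map Φ (StarAlgHom.id ℂ E)).comp Φ) := by
  unfold IsInducedComul familyComp
  rw [← MinTensor.assocRight_comp_assoc]
  constructor
  · exact fun h => StarAlgHom.ext fun m =>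
      MinTensor.assocRight_injective (DFunLike.congr_fun h m).symm
  · intro h
    rw [h]; rfl

theorem IsInducedComul.map_apply {Δ : E →⋆ₐ[ℂ] MinTensor E E} (hΔ : IsInducedComul Φ Δ) (m : M) :
    MinTensor.map (StarAlgHom.id ℂ M) Δ (Φ m) =
      MinTensor.assoc (MinTensor.map Φ (StarAlgHom.id ℂ E) (Φ m)) :=
  DFunLike.congr_fun (isInducedComul_iff.mp hΔ) m

/-- The relation `(id ⊗ ε) ∘ Φ = id`, in terms of a *-homomorphism `Λ` with values in a copy `D` of the
scalars. -/
theorem actsAsIdentity_iff {ε : E →⋆ₐ[ℂ] ℂ} {D : Type u} [CStarAlgebra D] {Λ : E →⋆ₐ[ℂ] D}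
    (hΛ : ∀ e, Λ e = algebraMap ℂ D (ε e))
    (hi : Function.Injective (MinTensor.inl : M →⋆ₐ[ℂ] MinTensor M D)) :
    ActsAsIdentity Φ ε ↔
      (MinTensor.map (StarAlgHom.id ℂ M) Λ).comp Φ = MinTensor.inl := by
  rw [MinTensor.map_id_scalar ε Λ hΛ]
  constructor
  · intro h
    exact StarAlgHom.ext fun m => congrArg MinTensor.inl (DFunLike.congr_fun h m)
  · exact fun h => StarAlgHom.ext fun m => hi (DFunLike.congr_fun h m)

theorem existsUnique_isInducedComul (hΦ : IsFamilyOfAllMaps Φ) :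
    ∃! Δ : E →⋆ₐ[ℂ] MinTensor E E, IsInducedComul Φ Δ := by
  simp only [isInducedComul_iff]
  exact hΦ _ _

theorem existsUnique_actsAsIdentity (hΦ : IsFamilyOfAllMaps Φ) :
    ∃! ε : E →⋆ₐ[ℂ] ℂ, ActsAsIdentity Φ ε := by
  let u : ULift.{u} ℂ ≃⋆ₐ[ℂ] ℂ := uliftStarAlgEquiv
  have hi : Function.Injective (MinTensor.inl : M →⋆ₐ[ℂ] MinTensor M (ULift.{u} ℂ)) :=
    Function.LeftInverse.injective (g := MinTensor.sliceRight (u : ULift.{u} ℂ →⋆ₐ[ℂ] ℂ))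
      fun m => (MinTensor.sliceRight_tmul _ m 1).trans (one_smul ℂ m)
  obtain ⟨Λ, hΛ, hu⟩ := hΦ (ULift.{u} ℂ) MinTensor.inl
  refine ⟨(u : ULift.{u} ℂ →⋆ₐ[ℂ] ℂ).comp Λ, (actsAsIdentity_iff (fun _ => rfl) hi).mpr hΛ,
    fun ε hε => ?_⟩
  have h := hu ((u.symm : ℂ →⋆ₐ[ℂ] ULift.{u} ℂ).comp ε)
    ((actsAsIdentity_iff (fun _ => rfl) hi).mp hε)
  rw [← h]
  rfl

/-- Both `(Δ ⊗ id) ∘ Δ` and `(id ⊗ Δ) ∘ Δ` induce the triple iterate of `Φ`. -/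
theorem isCoassociative_of_isInducedComul (hΦ : IsFamilyOfAllMaps Φ)
    {Δ : E →⋆ₐ[ℂ] MinTensor E E} (hΔ : IsInducedComul Φ Δ) : IsCoassociative Δ := by
  suffices h : (MinTensor.assoc.comp (MinTensor.map Δ (StarAlgHom.id ℂ E))).comp Δ =
      (MinTensor.map (StarAlgHom.id ℂ E) Δ).comp Δ by
    unfold IsCoassociative
    rw [← h, ← MinTensor.assocRight_comp_assoc]
    rfl
  let idM := StarAlgHom.id ℂ M
  let idE := StarAlgHom.id ℂ E
  -- the triple iterate `(Φ ⊗ id ⊗ id) ∘ (Φ ⊗ id) ∘ Φ`, to which both sides are compared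
  let Φ₃ (m : M) : MinTensor (MinTensor (MinTensor M E) E) E :=
    MinTensor.map (MinTensor.map Φ idE) idE (MinTensor.map Φ idE (Φ m))
  have hiter (m : M) : MinTensor.map (MinTensor.map idM Δ) idE (MinTensor.map Φ idE (Φ m)) =
      MinTensor.map MinTensor.assoc idE (Φ₃ m) :=
    (MinTensor.map_comp_id Φ (MinTensor.map idM Δ) (Φ m)).symm.trans <|
      (congrArg (fun f => MinTensor.map f idE (Φ m)) (isInducedComul_iff.mp hΔ)).trans <|
      (MinTensor.map_comp_id _ MinTensor.assoc (Φ m)).trans <|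
      congrArg (MinTensor.map MinTensor.assoc idE)
        (MinTensor.map_comp_id Φ (MinTensor.map Φ idE) (Φ m))
  have hleft (m : M) : MinTensor.map idM
      ((MinTensor.assoc.comp (MinTensor.map Δ idE)).comp Δ) (Φ m) =
      MinTensor.assoc (MinTensor.assoc (Φ₃ m)) :=
    (MinTensor.map_id_comp Δ (MinTensor.assoc.comp (MinTensor.map Δ idE)) (Φ m)).trans <|
      (congrArg _ (hΔ.map_apply m)).trans <|
      (MinTensor.map_id_comp (MinTensor.map Δ idE) MinTensor.assoc _).trans <|
      (congrArg (MinTensor.map idM MinTensor.assoc) <|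
        (MinTensor.map_assoc idM Δ idE _).trans (congrArg MinTensor.assoc (hiter m))).trans <|
      DFunLike.congr_fun MinTensor.assoc_pentagon (Φ₃ m)
  -- here `Δ` and `Φ` act on different factors, so that `(id ⊗ id ⊗ Δ) ∘ (Φ ⊗ id)` may be rewritten as
  -- `(Φ ⊗ id ⊗ id) ∘ (id ⊗ Δ)`
  have hright (m : M) : MinTensor.map idM ((MinTensor.map idE Δ).comp Δ) (Φ m) =
      MinTensor.assoc (MinTensor.assoc (Φ₃ m)) :=
    (MinTensor.map_id_comp Δ (MinTensor.map idE Δ) (Φ m)).trans <|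
      (congrArg _ (hΔ.map_apply m)).trans <|
      (MinTensor.map_assoc idM idE Δ _).trans <| congrArg MinTensor.assoc <|
      (congrArg (fun f => MinTensor.map f Δ (MinTensor.map Φ idE (Φ m)))
        MinTensor.map_id_id).trans <|
      (MinTensor.map_id_map Φ Δ (Φ m)).trans <|
      (MinTensor.map_map_id Φ Δ (Φ m)).symm.trans <|
      (congrArg (MinTensor.map Φ (StarAlgHom.id ℂ (MinTensor E E))) (hΔ.map_apply m)).trans <|
      (congrArg (fun f => MinTensor.map Φ f (MinTensor.assoc (MinTensor.map Φ idE (Φ m))))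
        MinTensor.map_id_id.symm).trans <|
      MinTensor.map_assoc Φ idE idE _
  exact hΦ.hom_ext fun m => (hleft m).trans (hright m).symm

theorem isCounit_of_actsAsIdentity (hΦ : IsFamilyOfAllMaps Φ)
    {Δ : E →⋆ₐ[ℂ] MinTensor E E} (hΔ : IsInducedComul Φ Δ) {ε : E →⋆ₐ[ℂ] ℂ}
    (hε : ActsAsIdentity Φ ε) : IsCounit Δ ε := by
  have hid (m : M) : MinTensor.sliceRight ε (Φ m) = m := DFunLike.congr_fun hε m
  have hmap (f : MinTensor E E →⋆ₐ[ℂ] E) (m : M) :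
      MinTensor.map (StarAlgHom.id ℂ M) (f.comp Δ) (Φ m) =
        ((MinTensor.map (StarAlgHom.id ℂ M) f).comp MinTensor.assoc)
          (MinTensor.map Φ (StarAlgHom.id ℂ E) (Φ m)) := by
    rw [StarAlgHom.comp_apply, ← hΔ.map_apply, MinTensor.map_map]
    rfl
  -- each of the two slices of `Δ` induces `Φ`, as the identity does
  constructor
  · refine hΦ.hom_ext fun m => ?_
    rw [hmap, MinTensor.map_sliceLeft_comp_assoc, MinTensor.map_map,
      show (MinTensor.sliceRight ε).comp Φ = StarAlgHom.id ℂ M from hε]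
    rfl
  · refine hΦ.hom_ext fun m => ?_
    rw [hmap, MinTensor.map_sliceRight_comp_assoc, MinTensor.map_id_id]
    refine (DFunLike.congr_fun (MinTensor.sliceRight_comp_map ε Φ) (Φ m)).trans ?_
    exact congrArg Φ (hid m)

end Semigroup

end QuantumSpace

theorem theorem5p1 {M E : Type u} [CStarAlgebra M] [FiniteDimensional ℂ M] [CStarAlgebra E]
    (Φ : M →⋆ₐ[ℂ] QuantumSpace.MinTensor M E) (hΦ : QuantumSpace.IsFamilyOfAllMaps Φ) :
    -- existence and uniqueness of the comultiplication
    (∃! Δ : E →⋆ₐ[ℂ] QuantumSpace.MinTensor E E, QuantumSpace.IsInducedComul Φ Δ) ∧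
    -- existence and uniqueness of the character
    (∃! ε : E →⋆ₐ[ℂ] ℂ, QuantumSpace.ActsAsIdentity Φ ε) ∧
    -- their properties
    (∀ Δ : E →⋆ₐ[ℂ] QuantumSpace.MinTensor E E, QuantumSpace.IsInducedComul Φ Δ →
      QuantumSpace.IsCoassociative Δ ∧
      (∀ ε : E →⋆ₐ[ℂ] ℂ, QuantumSpace.ActsAsIdentity Φ ε → QuantumSpace.IsCounit Δ ε) ∧
      QuantumSpace.IsCompactQuantumSemigroupWithUnit Δ) := by
  have hε := QuantumSpace.existsUnique_actsAsIdentity hΦ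
  refine ⟨QuantumSpace.existsUnique_isInducedComul hΦ, hε, fun Δ hΔ => ?_⟩
  have hco := QuantumSpace.isCoassociative_of_isInducedComul hΦ hΔ
  exact ⟨hco, fun ε h => QuantumSpace.isCounit_of_actsAsIdentity hΦ hΔ h, hco, hε.exists.imp
    fun ε h => QuantumSpace.isCounit_of_actsAsIdentity hΦ hΔ h⟩
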